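/- Let $\chi$ be an odd Dirichlet character of modulus $q>1$ (that is, $\chi(-1)=-1$; not necessarily primitive), let $L(\cdot,\chi)$ denote its Dirichlet $L$-function, continued to an entire function on $\mathbb{C}$, and for $n\ge 1$ and $s\in\mathbb{C}$ put \[ L_n(s,\chi)=\sum_{j=1}^{qn-1}\chi(j)\,\frac{\cot\left(\frac{\pi j}{qn}\right)}{\left[4\sin^2\left(\frac{\pi j}{qn}\right)\right]^{s}} . \] There are polynomials $b_k(s)$, $k\ge 0$, with $b_k$ of degree $k$ and independent of $q$ and $\chi$, given by the Laurent expansion (with the principal branch of the power) \[ \left(\frac{z/2}{\sin(z/2)}\right)^{2s}\cot(z/2)=\sum_{k\ge 0} b_k(s)\,z^{2k-1}\qquad (0<|z|<2\pi,\ s\in\mathbb{C}), \] such that, for every fixed $s\in\mathbb{C}$ and every integer $m\ge 0$, as $n\to\infty$, \[ L_n(s,\chi)=2\sum_{k=0}^{m} b_k(s)\,L(1+2(s-k),\chi)\left(\frac{qn}{2\pi}\right)^{1+2(s-k)}+\mathcal{O}\left(n^{1+2(s-(m+1))}\right), \] where the implied constant may depend on $\chi$, $q$, $s$ and $m$, and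 a complex power of $n$ inside $\mathcal{O}(\cdot)$ is understood in absolute value. -/

import Mathlib

/-- The cotangent-weighted discrete `L`-function on `ℤ/qnℤ`,
`L_n(s, χ) = ∑_{j=1}^{qn-1} χ(j) cot(πj/(qn)) / [4 sin²(πj/(qn))]^s`.
The base `4 sin²(πj/(qn))` is a positive real in every summand. -/
noncomputable def discreteOddL {q : ℕ} (χ : DirichletCharacter ℂ q) (n : ℕ) (s : ℂ) : ℂ :=
  ∑ j ∈ Finset.Ico 1 (q * n),
    χ (j : ZMod q) *
      ((Real.cot (Real.pi * (j : ℝ) / ((q : ℝ) * (n : ℝ))) : ℝ) : ℂ) /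
      ((4 * Real.sin (Real.pi * (j : ℝ) / ((q : ℝ) * (n : ℝ))) ^ 2 : ℝ) : ℂ) ^ s

open Filter Asymptotics Topology
open scoped Nat

/-! Put `N = qn` and `x = j/N`. Under `x ↦ 1 - x` both `χ` and the cotangent change sign, so the
summand is symmetric. A smooth cutoff `φ` with `φ(x) + φ(1 - x) = 1` therefore turns the sum into
twice the sum weighted by `φ`, and only the singularity at `x = 0` remains
(`sum_odd_mul_cotSummand`).

There the summand is `(2πx)^(-1-2s)` times an even power series in `2πx` with coefficients `b_k(s)`.
Each power contributes `∑ χ(j) φ(j/N) (j/N)^(-α)`, which equals `L(α, χ) N^α` up to an error smaller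
than any power of `N`, for every complex `α` (`sum_smoothCutoff_mul_cpow_isBigO`). The Taylor
remainder contributes a function vanishing to high order at `0`, hence of class `C^r`, whose sum
against `χ` is `O(N^(1-r))` (`sum_periodic_mul_isBigO`).

Both estimates come from repeated summation by parts. An odd character is nontrivial, so it has mean
zero over a period and is an `r`-fold difference of a periodic sequence. The differences then fall
on the smooth factor, each gaining `1/N`. The same device continues the Dirichlet series to the left
(`LFunction_eq_tsum_fwdDiff_powSeq`).

The degree of `b_k` is read off from `log((z/2)/sin(z/2)) = z²/24 + ⋯`: each factor `s` in the
exponential series comes with a factor `z²`. -/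

/-! ### Summation by parts against periodic sequences of mean zero -/

/-- `Ψ` is minus the partial sum of `Φ`, shifted by a constant so that it again has mean zero; this
is what allows the construction to be iterated. -/
theorem ZMod.exists_sub_shift_eq {q : ℕ} [NeZero q] (Φ : ZMod q → ℂ) (h : ∑ x, Φ x = 0) :
    ∃ Ψ : ZMod q → ℂ, ∑ x, Ψ x = 0 ∧ ∀ x, Ψ (x - 1) - Ψ x = Φ x := by
  set P : ℕ → ℂ := fun j => ∑ i ∈ Finset.range j, Φ (i : ZMod q) with hP
  have hPq : P q = 0 := by
    rw [← h, hP]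
    refine Finset.sum_bij' (fun i _ => (i : ZMod q)) (fun x _ => x.val) ?_ ?_ ?_ ?_ ?_
    · simp
    · intro x _; simpa using x.val_lt
    · intro i hi; simpa using ZMod.val_cast_of_lt (Finset.mem_range.mp hi)
    · simp
    · simp
  have key : ∀ x : ZMod q, P (x.val + 1) - P ((x - 1).val + 1) = Φ x := by
    intro x
    have h1 : P (x.val + 1) = P x.val + Φ x := by simp [hP, Finset.sum_range_succ]
    have h2 : P ((x - 1).val + 1) = P x.val := by
      -- At the wrap-around `x = 0` the partial sum over a whole period must agree with the empty
      -- one, which is the mean-zero hypothesis.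
      by_cases hx : x = 0
      · subst hx
        have : (0 - 1 : ZMod q).val + 1 = q := by
          rcases Nat.exists_eq_succ_of_ne_zero (NeZero.ne q) with ⟨k, rfl⟩
          simp [ZMod.val_neg_one]
        rw [this, hPq]; simp [hP]
      · have : (x - 1).val + 1 = x.val := by
          have hq : q ≠ 1 := by
            rintro rfl; exact hx (Subsingleton.elim _ _)
          have : Fact (1 < q) := ⟨by have := NeZero.ne q; omega⟩
          have hv : x.val ≠ 0 := by simpa using hx
          rw [ZMod.val_sub (by rw [ZMod.val_one]; omega), ZMod.val_one]; omega
        rw [this]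
    rw [h1, h2]; ring
  refine ⟨fun x => (∑ y : ZMod q, P (y.val + 1)) / q - P (x.val + 1), ?_, fun x => ?_⟩
  · have : (q : ℂ) ≠ 0 := Nat.cast_ne_zero.mpr (NeZero.ne q)
    simp [Finset.sum_sub_distrib, ZMod.card]
    field_simp
    simp
  · rw [← key x]; ring

theorem exists_norm_periodic_le {q : ℕ} [NeZero q] (Φ : ZMod q → ℂ) :
    ∃ B : ℝ, 0 ≤ B ∧ ∀ x, ‖Φ x‖ ≤ B :=
  ⟨∑ x, ‖Φ x‖, Finset.sum_nonneg fun _ _ => norm_nonneg _, fun x =>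
    Finset.single_le_sum (f := fun x => ‖Φ x‖) (fun _ _ => norm_nonneg _) (Finset.mem_univ x)⟩

theorem summable_periodic_mul {q : ℕ} [NeZero q] (Φ : ZMod q → ℂ) {g : ℤ → ℂ} (hg : Summable g) :
    Summable fun j : ℤ => Φ (j : ZMod q) * g j := by
  obtain ⟨B, -, hB⟩ := exists_norm_periodic_le Φ
  refine Summable.of_norm_bounded (hg.norm.mul_left B) fun j => ?_
  rw [norm_mul]
  exact mul_le_mul_of_nonneg_right (hB _) (norm_nonneg _)

/-- Repeated summation by parts against a periodic sequence of mean zero. -/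
theorem exists_tsum_periodic_mul_eq_tsum_fwdDiff {q : ℕ} [NeZero q] (r : ℕ) (Φ : ZMod q → ℂ)
    (h : ∑ x, Φ x = 0) :
    ∃ Ψ : ZMod q → ℂ, ∀ g : ℤ → ℂ, Summable g →
      ∑' j : ℤ, Φ (j : ZMod q) * g j = ∑' j : ℤ, Ψ (j : ZMod q) * ((fwdDiff 1)^[r] g) j := by
  induction r generalizing Φ with
  | zero => exact ⟨Φ, fun g _ => rfl⟩
  | succ r ih =>
    obtain ⟨Ψ₁, hΨ₁, hdiff⟩ := ZMod.exists_sub_shift_eq Φ h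
    obtain ⟨Ψ, hΨ⟩ := ih Ψ₁ hΨ₁
    refine ⟨Ψ, fun g hg => ?_⟩
    have hg1 : Summable fun j : ℤ => g (j + 1) :=
      (Equiv.addRight (1 : ℤ)).summable_iff.mpr hg
    have hΔ : Summable (fwdDiff 1 g) := hg1.sub hg
    rw [Function.iterate_succ_apply, ← hΨ _ hΔ]
    have e1 : ∑' j : ℤ, Ψ₁ ((j : ZMod q) - 1) * g j = ∑' j : ℤ, Ψ₁ (j : ZMod q) * g (j + 1) := by
      rw [← (Equiv.addRight (1 : ℤ)).tsum_eq]
      simp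
    have s1 : Summable fun j : ℤ => Ψ₁ ((j : ZMod q) - 1) * g j :=
      summable_periodic_mul (fun x => Ψ₁ (x - 1)) hg
    have s2 := summable_periodic_mul Ψ₁ hg
    have s3 := summable_periodic_mul Ψ₁ hg1
    calc ∑' j : ℤ, Φ (j : ZMod q) * g j
        = ∑' j : ℤ, (Ψ₁ ((j : ZMod q) - 1) * g j - Ψ₁ (j : ZMod q) * g j) :=
          tsum_congr fun j => by rw [← hdiff]; ring
      _ = ∑' j : ℤ, Ψ₁ (j : ZMod q) * g (j + 1) - ∑' j : ℤ, Ψ₁ (j : ZMod q) * g j := by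
          rw [s1.tsum_sub s2, e1]
      _ = _ := by
          rw [← s3.tsum_sub s2]
          exact tsum_congr fun j => by simp only [fwdDiff]; ring

/-! ### Locality and size of iterated differences -/

theorem fwdDiff_iter_congr {f g : ℤ → ℂ} {r : ℕ} {j : ℤ}
    (h : ∀ i, j ≤ i → i ≤ j + r → f i = g i) : ((fwdDiff 1)^[r] f) j = ((fwdDiff 1)^[r] g) j := by
  rw [fwdDiff_iter_eq_sum_shift, fwdDiff_iter_eq_sum_shift]
  refine Finset.sum_congr rfl fun k hk => ?_
  have := Finset.mem_range.mp hk
  rw [h]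
  · simp
  · simp; omega

theorem fwdDiff_iter_eq_zero {f : ℤ → ℂ} {r : ℕ} {j : ℤ}
    (h : ∀ i, j ≤ i → i ≤ j + r → f i = 0) : ((fwdDiff 1)^[r] f) j = 0 := by
  rw [fwdDiff_iter_congr (g := fun _ => 0) h, fwdDiff_iter_eq_sum_shift]
  simp

/-- The mean value inequality, applied `r` times. A chain `D` of successive derivatives is carried
along because the induction replaces every `D i` by `D i (x + 1) - D i x`. -/
theorem norm_fwdDiff_iter_le (r : ℕ) (D : ℕ → ℝ → ℂ) (a : ℤ) (C : ℝ)
    (hD : ∀ i < r, ∀ x ∈ Set.Icc (a : ℝ) (a + r), HasDerivAt (D i) (D (i + 1) x) x)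
    (hC : ∀ x ∈ Set.Icc (a : ℝ) (a + r), ‖D r x‖ ≤ C) :
    ‖((fwdDiff 1)^[r] fun j : ℤ => D 0 j) a‖ ≤ C := by
  induction r generalizing D with
  | zero => simpa using hC a (by simp)
  | succ r ih =>
    rw [Function.iterate_succ_apply]
    have e : (fwdDiff 1 fun j : ℤ => D 0 j) = fun j : ℤ => (fun i x => D i (x + 1) - D i x) 0 (j : ℝ) := by
      ext j; simp [fwdDiff]
    have sub : ∀ x ∈ Set.Icc (a : ℝ) (a + r), ∀ y ∈ Set.Icc x (x + 1),
        y ∈ Set.Icc (a : ℝ) (a + (r + 1 : ℕ)) := by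
      intro x hx y hy
      push_cast
      exact ⟨hx.1.trans hy.1, by linarith [hy.2, hx.2]⟩
    rw [e]
    refine ih (fun i x => D i (x + 1) - D i x) ?_ ?_
    · intro i hi x hx
      have h1 := hD i (by omega) (x + 1) (sub x hx _ (by simp))
      have h2 := hD i (by omega) x (sub x hx _ (by simp))
      exact (h1.comp_add_const x 1).sub h2
    · intro x hx
      have := (convex_Icc x (x + 1)).norm_image_sub_le_of_norm_hasDerivWithin_le
        (f := D r) (f' := D (r + 1)) (C := C)
        (fun y hy => (hD r (by omega) y (sub x hx y hy)).hasDerivWithinAt)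
        (fun y hy => hC y (sub x hx y hy)) (Set.left_mem_Icc.mpr (by linarith))
        (Set.right_mem_Icc.mpr (by linarith : x ≤ x + 1))
      simpa using this

/-- Finite differences of a `C^r` function sampled at the points `j / N`. -/
theorem ContDiff.exists_norm_fwdDiff_iter_le {r : ℕ} {F : ℝ → ℂ} (hF : ContDiff ℝ r F) :
    ∃ C : ℝ, 0 ≤ C ∧ ∀ N : ℕ, 1 ≤ N → ∀ j : ℤ, -(r : ℤ) ≤ j → j ≤ N →
      ‖((fwdDiff 1)^[r] fun j : ℤ => F (j / N)) j‖ ≤ C * (N : ℝ)⁻¹ ^ r := by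
  obtain ⟨C, hC⟩ := (isCompact_Icc (a := -(r : ℝ)) (b := 1 + r)).exists_bound_of_continuousOn
    (hF.continuous_iteratedDeriv r le_rfl).continuousOn
  refine ⟨max C 0, le_max_right _ _, fun N hN j hj1 hj2 => ?_⟩
  have hN' : (1 : ℝ) ≤ N := by exact_mod_cast hN
  have hj1' : -(r : ℝ) ≤ j := by exact_mod_cast hj1
  have hj2' : (j : ℝ) ≤ N := by exact_mod_cast hj2
  -- By the chain rule the `i`-th derivative of `x ↦ F (x / N)` carries `N⁻¹ ^ i`; the range of `j`
  -- keeps every `x / N` in the compact interval `[-r, 1 + r]`.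
  have := norm_fwdDiff_iter_le r
    (fun i x => (((N : ℝ)⁻¹ ^ i : ℝ) : ℂ) * iteratedDeriv i F (x / N)) j (max C 0 * (N : ℝ)⁻¹ ^ r) ?_ ?_
  · simpa using this
  · intro i hi x _
    have h1 : HasDerivAt (iteratedDeriv i F) (iteratedDeriv (i + 1) F (x / N)) (x / N) := by
      rw [iteratedDeriv_succ]
      exact (hF.differentiable_iteratedDeriv i (by exact_mod_cast hi) _).hasDerivAt
    have h2 : HasDerivAt (fun x : ℝ => x / N) ((N : ℝ)⁻¹) x := by
      simpa using (hasDerivAt_id x).div_const (N : ℝ)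
    have h3 := (h1.scomp x h2).const_mul ((((N : ℝ)⁻¹ ^ i : ℝ) : ℂ))
    refine h3.congr_deriv ?_
    rw [Complex.real_smul, pow_succ]; push_cast; ring
  · intro x hx
    rw [norm_mul, Complex.norm_real, Real.norm_of_nonneg (by positivity), mul_comm]
    refine mul_le_mul_of_nonneg_right ((hC _ ?_).trans (le_max_left _ _)) (by positivity)
    have hN0 : (0 : ℝ) < N := by linarith
    have hr : (0 : ℝ) ≤ r := Nat.cast_nonneg r
    constructor
    · rw [le_div_iff₀ hN0]; nlinarith [hx.1]
    · rw [div_le_iff₀ hN0]; nlinarith [hx.2]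

/-! ### Sums of compactly supported smooth functions against periodic sequences -/

theorem tsum_int_eq_sum_Ico (N : ℕ) (u : ℤ → ℂ) (h0 : ∀ j ≤ 0, u j = 0)
    (hN : ∀ j : ℤ, (N : ℤ) ≤ j → u j = 0) : ∑' j : ℤ, u j = ∑ j ∈ Finset.Ico 1 N, u (j : ℤ) := by
  rw [tsum_eq_sum (s := Finset.Ico (1 : ℤ) N)]
  · refine Finset.sum_bij' (fun j _ => j.toNat) (fun j _ => (j : ℤ)) ?_ ?_ ?_ ?_ ?_ <;>
      simp only [Finset.mem_Ico] <;> intro j hj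
    · omega
    · omega
    · omega
    · simp
    · congr 1; omega
  · intro j hj
    rw [Finset.mem_Ico, not_and_or] at hj
    rcases hj with h | h
    · exact h0 j (by omega)
    · exact hN j (by omega)

theorem Int.card_Icc_neg_natCast (r N : ℕ) :
    ((Finset.Icc (-(r : ℤ)) N).card : ℝ) = N + r + 1 := by
  have : (Finset.Icc (-(r : ℤ)) N).card = N + r + 1 := by rw [Int.card_Icc]; omega
  rw [this]; push_cast; ring

/-- After `r` summations by parts, `N + r + 1 ≤ (r + 2) N` differences can be nonzero, each
`O(N^(-r))`. The window starts at `-r` because a difference at `j` looks ahead to `j + r`. -/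
theorem sum_periodic_mul_isBigO {q : ℕ} [NeZero q] (Φ : ZMod q → ℂ) (h : ∑ x, Φ x = 0) {r : ℕ}
    {F : ℝ → ℂ} (hF : ContDiff ℝ r F) (h0 : ∀ x ≤ 0, F x = 0) (h1 : ∀ x, 1 ≤ x → F x = 0) :
    (fun N : ℕ => ∑ j ∈ Finset.Ico 1 N, Φ (j : ZMod q) * F (j / N)) =O[atTop]
      fun N : ℕ => (N : ℝ) ^ (1 - r : ℝ) := by
  obtain ⟨Ψ, hΨ⟩ := exists_tsum_periodic_mul_eq_tsum_fwdDiff r Φ h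
  obtain ⟨B, hB0, hB⟩ := exists_norm_periodic_le Ψ
  obtain ⟨C, hC0, hC⟩ := hF.exists_norm_fwdDiff_iter_le
  refine IsBigO.of_bound ((r + 2) * (B * C)) ?_
  filter_upwards [eventually_ge_atTop 1] with N hN
  have hN' : (1 : ℝ) ≤ N := by exact_mod_cast hN
  have hN0 : (0 : ℝ) < N := by linarith
  set g : ℤ → ℂ := fun j => F (j / N) with hg
  have g0 : ∀ j ≤ 0, g j = 0 := fun j hj =>
    h0 _ (div_nonpos_of_nonpos_of_nonneg (by exact_mod_cast hj) hN0.le)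
  have gN : ∀ j : ℤ, (N : ℤ) ≤ j → g j = 0 := fun j hj =>
    h1 _ ((one_le_div hN0).mpr (by exact_mod_cast hj))
  have gs : Summable g := summable_of_ne_finset_zero (s := Finset.Ico (1 : ℤ) N) (by
    intro j hj
    rw [Finset.mem_Ico, not_and_or] at hj
    rcases hj with h | h
    · exact g0 j (by omega)
    · exact gN j (by omega))
  have e1 : ∑ j ∈ Finset.Ico 1 N, Φ (j : ZMod q) * F (j / N)
      = ∑ j ∈ Finset.Icc (-(r : ℤ)) N, Ψ (j : ZMod q) * ((fwdDiff 1)^[r] g) j := by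
    rw [← tsum_eq_sum (L := .unconditional ℤ) (f := fun j : ℤ => Ψ (j : ZMod q) * ((fwdDiff 1)^[r] g) j), ← hΨ g gs,
      tsum_int_eq_sum_Ico N]
    · simp [hg]
    · intro j hj; rw [g0 j hj, mul_zero]
    · intro j hj; rw [gN j hj, mul_zero]
    · intro j hj
      rw [Finset.mem_Icc, not_and_or] at hj
      rw [fwdDiff_iter_eq_zero, mul_zero]
      intro i hi1 hi2
      rcases hj with h | h
      · exact g0 i (by omega)
      · exact gN i (by omega)
  rw [e1]
  calc _ ≤ ∑ j ∈ Finset.Icc (-(r : ℤ)) N, B * (C * (N : ℝ)⁻¹ ^ r) := by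
        refine norm_sum_le_of_le _ fun j hj => ?_
        rw [Finset.mem_Icc] at hj
        rw [norm_mul]
        exact mul_le_mul (hB _) (hC N hN j hj.1 hj.2) (norm_nonneg _) hB0
    _ = (N + r + 1) * (B * (C * (N : ℝ)⁻¹ ^ r)) := by
        rw [Finset.sum_const, nsmul_eq_mul, Int.card_Icc_neg_natCast]
    _ ≤ ((r + 2) * N) * (B * (C * (N : ℝ)⁻¹ ^ r)) := by
        have hr : (0 : ℝ) ≤ r := Nat.cast_nonneg r
        refine mul_le_mul_of_nonneg_right (by nlinarith) (by positivity)
    _ = _ := by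
        rw [Real.norm_of_nonneg (by positivity), Real.rpow_sub hN0, Real.rpow_one,
          Real.rpow_natCast, inv_pow]
        field_simp

/-! ### The smooth cutoff -/

/-- A smooth cutoff function on `ℝ`, equal to `1` on `(-∞, 1/3]` and to `0` on `[2/3, ∞)`. -/
noncomputable def smoothCutoff (x : ℝ) : ℝ := 1 - Real.smoothTransition (3 * x - 1)

theorem smoothCutoff_of_le {x : ℝ} (h : x ≤ 1 / 3) : smoothCutoff x = 1 := by
  rw [smoothCutoff, Real.smoothTransition.zero_of_nonpos (by linarith), sub_zero]

theorem smoothCutoff_of_ge {x : ℝ} (h : 2 / 3 ≤ x) : smoothCutoff x = 0 := by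
  rw [smoothCutoff, Real.smoothTransition.one_of_one_le (by linarith), sub_self]

theorem smoothCutoff_add_smoothCutoff_one_sub (x : ℝ) :
    smoothCutoff x + smoothCutoff (1 - x) = 1 := by
  have h := (Real.smoothTransition.pos_denom (3 * x - 1)).ne'
  have e : 3 * (1 - x) - 1 = 1 - (3 * x - 1) := by ring
  rw [smoothCutoff, smoothCutoff, e, Real.smoothTransition, Real.smoothTransition, sub_sub_cancel,
    add_comm (expNegInvGlue (1 - (3 * x - 1)))]
  field_simp
  ring

theorem contDiff_smoothCutoff {n : ℕ∞} : ContDiff ℝ n smoothCutoff :=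
  contDiff_const.sub (Real.smoothTransition.contDiff.comp (by fun_prop))

/-! ### Differences of powers and continuation of the Dirichlet series -/

theorem hasDerivAt_ofReal_cpow_of_pos {x : ℝ} (hx : 0 < x) (c : ℂ) :
    HasDerivAt (fun y : ℝ => (y : ℂ) ^ c) (c * (x : ℂ) ^ (c - 1)) x := by
  have := ((hasDerivAt_id (x : ℂ)).cpow_const (c := c)
    (Complex.ofReal_mem_slitPlane.mpr hx)).comp_ofReal
  simpa using this

/-- The sequence `j ↦ j ^ (-α)`, extended by zero to the nonpositive integers. -/
noncomputable def powSeq (α : ℂ) (j : ℤ) : ℂ := if 0 < j then (j : ℂ) ^ (-α) else 0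

theorem norm_powSeq_of_pos (α : ℂ) {j : ℤ} (hj : 0 < j) :
    ‖powSeq α j‖ = (j : ℝ) ^ (-α.re) := by
  have : (0 : ℝ) < j := by exact_mod_cast hj
  rw [powSeq, if_pos hj, ← Complex.ofReal_intCast, Complex.norm_cpow_eq_rpow_re_of_pos this,
    Complex.neg_re]

/-- The `r`-th derivative of `x^(-α)` is a product of `r` factors of size at most `‖α‖ + r`, times
`x^(-α-r)`; the hypothesis on `α` makes the modulus of that power largest at the left end `j`. -/
theorem norm_fwdDiff_iter_powSeq_le (r : ℕ) {α : ℂ} (hα : 0 ≤ α.re + r) {j : ℤ} (hj : 0 < j) :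
    ‖((fwdDiff 1)^[r] (powSeq α)) j‖ ≤ (‖α‖ + r) ^ r * (j : ℝ) ^ (-(α.re + r)) := by
  have hj' : (0 : ℝ) < j := by exact_mod_cast hj
  set D : ℕ → ℝ → ℂ := fun i x => (∏ l ∈ Finset.range i, (-α - l)) * (x : ℂ) ^ (-α - i) with hD
  have e : ((fwdDiff 1)^[r] (powSeq α)) j = ((fwdDiff 1)^[r] fun j : ℤ => D 0 j) j := by
    refine fwdDiff_iter_congr fun i hi _ => ?_
    rw [powSeq, if_pos (by omega)]
    simp [hD]
  rw [e]
  refine norm_fwdDiff_iter_le r D j _ (fun i _ x hx => ?_) (fun x hx => ?_)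
  · have hx0 : 0 < x := hj'.trans_le hx.1
    refine ((hasDerivAt_ofReal_cpow_of_pos hx0 (-α - i)).const_mul
      (∏ l ∈ Finset.range i, (-α - l))).congr_deriv ?_
    simp only [hD]
    rw [Finset.prod_range_succ, show -α - ((i + 1 : ℕ) : ℂ) = -α - i - 1 by push_cast; ring]
    ring
  · have hx0 : 0 < x := hj'.trans_le hx.1
    rw [hD, norm_mul, Complex.norm_cpow_eq_rpow_re_of_pos hx0, norm_prod]
    refine mul_le_mul ?_ ?_ (by positivity) (by positivity)
    · calc _ ≤ ∏ l ∈ Finset.range r, (‖α‖ + r) := by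
            refine Finset.prod_le_prod (fun _ _ => norm_nonneg _) fun l hl => ?_
            refine (norm_sub_le _ _).trans ?_
            rw [norm_neg, Complex.norm_natCast]
            have : (l : ℝ) ≤ r := by exact_mod_cast (Finset.mem_range.mp hl).le
            linarith
        _ = _ := by simp
    · have : (-α - (r : ℂ)).re = -(α.re + r) := by simp; ring
      rw [this]
      exact Real.rpow_le_rpow_of_nonpos hj' hx.1 (by linarith)

theorem norm_fwdDiff_iter_le_two_pow {f : ℤ → ℂ} {r : ℕ} {j : ℤ} {K : ℝ}
    (h : ∀ i, j ≤ i → i ≤ j + r → ‖f i‖ ≤ K) : ‖((fwdDiff 1)^[r] f) j‖ ≤ 2 ^ r * K := by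
  rw [fwdDiff_iter_eq_sum_shift]
  calc _ ≤ ∑ k ∈ Finset.range (r + 1), (r.choose k : ℝ) * K := by
        refine norm_sum_le_of_le _ fun k hk => ?_
        have := Finset.mem_range.mp hk
        have h1 := h (j + k • 1) (by simp) (by simp; omega)
        rw [← Int.cast_smul_eq_zsmul ℂ, smul_eq_mul, norm_mul]
        refine mul_le_mul (le_of_eq ?_) h1 (norm_nonneg _) (by positivity)
        push_cast
        rw [norm_mul, norm_pow, norm_neg, norm_one, one_pow, one_mul, Complex.norm_natCast]
    _ = _ := by
        rw [← Finset.sum_mul]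
        congr 1
        exact_mod_cast Nat.sum_range_choose r

/-- A bound for the differences of `powSeq` that is summable and locally uniform in `α`. -/
theorem norm_fwdDiff_iter_powSeq_le_uniform (r : ℕ) {ρ p : ℝ} (hp : 0 ≤ p) {α : ℂ} (hρ : ‖α‖ ≤ ρ)
    (hα : p ≤ α.re + r) (j : ℤ) :
    ‖((fwdDiff 1)^[r] (powSeq α)) j‖ ≤ (ρ + r) ^ r * |(j : ℝ)| ^ (-p) +
      if j ∈ Finset.Icc (-(r : ℤ)) 0 then 2 ^ r * (r + 1 : ℝ) ^ ρ else 0 := by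
  have hρ0 : 0 ≤ ρ := (norm_nonneg _).trans hρ
  rcases lt_or_ge 0 j with hj | hj
  · rw [if_neg (by simp; omega), add_zero]
    have hj' : (1 : ℝ) ≤ j := by exact_mod_cast hj
    refine (norm_fwdDiff_iter_powSeq_le r (hp.trans hα) hj).trans ?_
    rw [abs_of_nonneg (by linarith)]
    gcongr
  -- For `-r ≤ j ≤ 0` the difference may straddle the cut-off of `powSeq` at `0`, where smoothness
  -- is lost; the crude binomial bound suffices for these finitely many `j`.
  · by_cases hjr : -(r : ℤ) ≤ j
    · rw [if_pos (by simp; omega)]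
      refine (norm_fwdDiff_iter_le_two_pow (K := (r + 1 : ℝ) ^ ρ) fun i _ hi => ?_).trans
        (le_add_of_nonneg_left (by positivity))
      rcases lt_or_ge 0 i with hi0 | hi0
      · rw [norm_powSeq_of_pos α hi0]
        have h1 : (1 : ℝ) ≤ i := by exact_mod_cast hi0
        have h2 : (i : ℝ) ≤ r + 1 := by
          have : i ≤ r + 1 := by omega
          exact_mod_cast this
        have h3 : -α.re ≤ ρ := (neg_le_abs _).trans ((Complex.abs_re_le_norm α).trans hρ)
        calc (i : ℝ) ^ (-α.re) ≤ (i : ℝ) ^ ρ := Real.rpow_le_rpow_of_exponent_le h1 h3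
          _ ≤ _ := Real.rpow_le_rpow (by linarith) h2 hρ0
      · rw [powSeq, if_neg (by omega), norm_zero]; positivity
    · rw [fwdDiff_iter_eq_zero, norm_zero]
      · positivity
      · intro i _ hi
        rw [powSeq, if_neg (by omega)]

theorem summable_powSeq_bound (r : ℕ) (c K : ℝ) {p : ℝ} (hp : 1 < p) :
    Summable fun j : ℤ => c * |(j : ℝ)| ^ (-p) +
      if j ∈ Finset.Icc (-(r : ℤ)) 0 then K else 0 := by
  refine ((Real.summable_abs_int_rpow hp).mul_left c).add ?_
  exact summable_of_ne_finset_zero (s := Finset.Icc (-(r : ℤ)) 0) fun j hj => if_neg hj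

theorem summable_fwdDiff_iter_powSeq (r : ℕ) {α : ℂ} (hα : 1 < α.re + r) :
    Summable ((fwdDiff 1)^[r] (powSeq α)) :=
  Summable.of_norm_bounded (summable_powSeq_bound r _ _ hα)
    (norm_fwdDiff_iter_powSeq_le_uniform r (by linarith) le_rfl le_rfl)

theorem differentiable_powSeq (j : ℤ) : Differentiable ℂ fun α => powSeq α j := by
  unfold powSeq
  split_ifs with h
  · have : (j : ℂ) ≠ 0 := by exact_mod_cast h.ne'
    intro α
    exact (differentiableAt_id.neg).const_cpow (Or.inl this)
  · exact differentiable_const _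

theorem differentiable_fwdDiff_iter_powSeq (r : ℕ) (j : ℤ) :
    Differentiable ℂ fun α => ((fwdDiff 1)^[r] (powSeq α)) j := by
  simp only [fwdDiff_iter_eq_sum_shift, ← Int.cast_smul_eq_zsmul ℂ, smul_eq_mul]
  exact Differentiable.fun_sum fun k _ => (differentiable_powSeq _).const_mul _

theorem differentiableAt_tsum_fwdDiff_powSeq {q : ℕ} [NeZero q] (Ψ : ZMod q → ℂ) (r : ℕ) {α : ℂ}
    (hα : 1 < α.re + r) :
    DifferentiableAt ℂ (fun α => ∑' j : ℤ, Ψ (j : ZMod q) * ((fwdDiff 1)^[r] (powSeq α)) j) α := by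
  obtain ⟨B, hB0, hB⟩ := exists_norm_periodic_le Ψ
  obtain ⟨p, hp1, hp2⟩ := exists_between hα
  -- A neighbourhood on which one summable majorant serves all exponents, so that the series of
  -- entire functions may be differentiated.
  set U : Set ℂ := {w | ‖w‖ < ‖α‖ + 1} ∩ {w | p < w.re + r} with hU
  have hUo : IsOpen U := (isOpen_lt continuous_norm continuous_const).inter
    (isOpen_lt continuous_const (by fun_prop))
  have hαU : α ∈ U := ⟨by simp, hp2⟩
  refine (Complex.differentiableOn_tsum_of_summable_norm
    ((summable_powSeq_bound r ((‖α‖ + 1 + r) ^ r) (2 ^ r * (r + 1 : ℝ) ^ (‖α‖ + 1)) hp1).mul_left B)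
    (fun j => ((differentiable_fwdDiff_iter_powSeq r j).const_mul _).differentiableOn) hUo
    fun j w hw => ?_).differentiableAt (hUo.mem_nhds hαU)
  rw [norm_mul]
  exact mul_le_mul (hB _) (norm_fwdDiff_iter_powSeq_le_uniform r (by linarith) hw.1.le hw.2.le j)
    (norm_nonneg _) hB0

theorem tsum_periodic_mul_powSeq_eq_LFunction {q : ℕ} [NeZero q] (χ : DirichletCharacter ℂ q)
    {α : ℂ} (hα : 1 < α.re) :
    ∑' j : ℤ, χ (j : ZMod q) * powSeq α j = DirichletCharacter.LFunction χ α := by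
  rw [DirichletCharacter.LFunction_eq_LSeries χ hα, LSeries,
    ← (Nat.cast_injective (R := ℤ)).tsum_eq]
  · refine tsum_congr fun n => ?_
    rcases Nat.eq_zero_or_pos n with rfl | hn
    · simp [powSeq]
    · rw [LSeries.term_of_ne_zero hn.ne', powSeq, if_pos (by exact_mod_cast hn), Complex.cpow_neg]
      simp [div_eq_mul_inv]
  · intro j hj
    have : 0 < j := by
      by_contra h
      exact hj (by simp [powSeq, h])
    exact ⟨j.toNat, by simp [this.le]⟩

/-- Summation by parts continues the Dirichlet series of `χ` to the half-plane `1 - r < re α`. -/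
theorem LFunction_eq_tsum_fwdDiff_powSeq {q : ℕ} [NeZero q] {χ : DirichletCharacter ℂ q}
    (hχ : χ ≠ 1) {r : ℕ} {Ψ : ZMod q → ℂ}
    (hΨ : ∀ g : ℤ → ℂ, Summable g →
      ∑' j : ℤ, χ (j : ZMod q) * g j = ∑' j : ℤ, Ψ (j : ZMod q) * ((fwdDiff 1)^[r] g) j)
    {α : ℂ} (hα : 1 < α.re + r) :
    ∑' j : ℤ, Ψ (j : ZMod q) * ((fwdDiff 1)^[r] (powSeq α)) j =
      DirichletCharacter.LFunction χ α := by
  set V : Set ℂ := {w | 1 - (r : ℝ) < w.re} with hV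
  have hVo : IsOpen V := isOpen_lt continuous_const Complex.continuous_re
  have hVc : IsPreconnected V := (convex_halfSpace_re_gt _).isPreconnected
  have h1 : AnalyticOnNhd ℂ
      (fun α => ∑' j : ℤ, Ψ (j : ZMod q) * ((fwdDiff 1)^[r] (powSeq α)) j) V :=
    DifferentiableOn.analyticOnNhd (fun w hw => (differentiableAt_tsum_fwdDiff_powSeq Ψ r (by
      have : 1 - (r : ℝ) < w.re := hw
      linarith)).differentiableWithinAt) hVo
  have h2 : AnalyticOnNhd ℂ (DirichletCharacter.LFunction χ) V :=
    (DirichletCharacter.differentiable_LFunction hχ).differentiableOn.analyticOnNhd hVo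
  have h2V : (2 : ℂ) ∈ V := by
    have : (0 : ℝ) ≤ r := Nat.cast_nonneg r
    show 1 - (r : ℝ) < (2 : ℂ).re
    simp; linarith
  -- Identity theorem: near `2` the Dirichlet series converges absolutely and summation by parts is
  -- legitimate.
  refine h1.eqOn_of_preconnected_of_eventuallyEq h2 hVc h2V ?_
    (show 1 - (r : ℝ) < α.re by linarith)
  have : {w : ℂ | 1 < w.re} ∈ 𝓝 (2 : ℂ) :=
    (isOpen_lt continuous_const Complex.continuous_re).mem_nhds (by simp)
  filter_upwards [this] with w hw
  have hs : Summable (powSeq w) := summable_fwdDiff_iter_powSeq 0 (by simpa using hw)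
  rw [← hΨ _ hs, tsum_periodic_mul_powSeq_eq_LFunction χ hw]

/-! ### Smoothly truncated Dirichlet series -/

/-- The factor `1 - smoothCutoff x` vanishes for `x ≤ 1/3`, hence near the singularity of the power,
so no condition on `α` is needed. -/
theorem contDiff_one_sub_smoothCutoff_mul_cpow (α : ℂ) (n : ℕ) :
    ContDiff ℝ n fun x : ℝ => ((1 - smoothCutoff x : ℝ) : ℂ) * (x : ℂ) ^ (-α) := by
  rw [contDiff_iff_contDiffAt]
  intro x
  rcases lt_or_ge x (1 / 3) with hx | hx
  · have : (fun x : ℝ => ((1 - smoothCutoff x : ℝ) : ℂ) * (x : ℂ) ^ (-α)) =ᶠ[𝓝 x] fun _ => 0 := by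
      filter_upwards [Iio_mem_nhds hx] with y hy
      rw [smoothCutoff_of_le (le_of_lt hy)]; simp
    exact contDiffAt_const.congr_of_eventuallyEq this
  · have hx0 : 0 < x := by linarith
    refine ContDiffAt.mul ?_ ?_
    · exact Complex.ofRealCLM.contDiff.contDiffAt.comp x
        (contDiffAt_const.sub (contDiff_smoothCutoff (n := n)).contDiffAt)
    · have h1 : AnalyticAt ℂ (fun z : ℂ => z ^ (-α)) (x : ℂ) :=
        analyticAt_id.cpow analyticAt_const (Complex.ofReal_mem_slitPlane.mpr hx0)
      exact (h1.contDiffAt (n := n)).restrict_scalars ℝ |>.comp x Complex.ofRealCLM.contDiff.contDiffAt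

theorem sum_apply_eq_zero_of_ne_one {q : ℕ} [NeZero q] {χ : DirichletCharacter ℂ q} (hχ : χ ≠ 1) :
    ∑ x, χ x = 0 := MulChar.sum_eq_zero_of_ne_one hχ

/-- The smoothly truncated Dirichlet series `∑ χ(j) j ^ (-α)` approximates `L(α, χ)` to all orders,
for every complex `α`. -/
theorem sum_smoothCutoff_mul_cpow_isBigO {q : ℕ} [NeZero q] {χ : DirichletCharacter ℂ q}
    (hχ : χ ≠ 1) (α : ℂ) (K : ℝ) :
    (fun N : ℕ => ∑ j ∈ Finset.Ico 1 N,
        χ (j : ZMod q) * ((smoothCutoff (j / N) : ℂ) * (((j / N : ℝ) : ℂ)) ^ (-α)) -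
      DirichletCharacter.LFunction χ α * (N : ℂ) ^ α) =O[atTop] fun N : ℕ => (N : ℝ) ^ K := by
  -- The final error is `O(N^(2-r))`, so `r ≥ 2 - K` is required; `re α + r ≥ 2` lets the tail be
  -- compared with `∑ |j|^(-2)`.
  obtain ⟨r, hr⟩ := exists_nat_ge (max (2 - K) (2 - α.re))
  have hrK : 2 - r ≤ K := by linarith [(le_max_left _ _).trans hr]
  have hrα : 2 ≤ α.re + r := by linarith [(le_max_right _ _).trans hr]
  obtain ⟨Ψ, hΨ⟩ := exists_tsum_periodic_mul_eq_tsum_fwdDiff r χ (sum_apply_eq_zero_of_ne_one hχ)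
  obtain ⟨B, hB0, hB⟩ := exists_norm_periodic_le Ψ
  obtain ⟨C, hC0, hC⟩ := (contDiff_one_sub_smoothCutoff_mul_cpow α r).exists_norm_fwdDiff_iter_le
  set Z : ℝ := ∑' j : ℤ, |(j : ℝ)| ^ (-2 : ℝ) with hZ
  have hZs : Summable fun j : ℤ => |(j : ℝ)| ^ (-2 : ℝ) := Real.summable_abs_int_rpow (by norm_num)
  set P : ℝ := (‖α‖ + r) ^ r with hP
  have hP0 : 0 ≤ P := by positivity
  refine IsBigO.of_bound (B * ((r + 2) * C + P * Z)) ?_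
  filter_upwards [eventually_ge_atTop 1] with N hN
  have hN' : (1 : ℝ) ≤ N := by exact_mod_cast hN
  have hN0 : (0 : ℝ) < N := by linarith
  have hNc : (N : ℂ) ≠ 0 := by exact_mod_cast hN0.ne'
  set gφ : ℤ → ℂ := fun j => (smoothCutoff (j / N) : ℂ) * powSeq α j with hgφ
  set gc : ℤ → ℂ := fun j => ((1 - smoothCutoff (j / N) : ℝ) : ℂ) * powSeq α j with hgc
  have gφ0 : ∀ j ≤ 0, gφ j = 0 := fun j hj => by simp [hgφ, powSeq, hj]
  have cutN : ∀ j : ℤ, (N : ℤ) ≤ j → smoothCutoff (j / N) = 0 := fun j hj => by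
    refine smoothCutoff_of_ge ?_
    have : (1 : ℝ) ≤ j / N := (one_le_div hN0).mpr (by exact_mod_cast hj)
    linarith
  have gφN : ∀ j : ℤ, (N : ℤ) ≤ j → gφ j = 0 := fun j hj => by simp [hgφ, cutN j hj]
  have gφs : Summable gφ := summable_of_ne_finset_zero (s := Finset.Ico (1 : ℤ) N) (by
    intro j hj
    rw [Finset.mem_Ico, not_and_or] at hj
    rcases hj with h | h
    · exact gφ0 j (by omega)
    · exact gφN j (by omega))
  have gφΔ : Summable ((fwdDiff 1)^[r] gφ) := by
    refine summable_of_ne_finset_zero (s := Finset.Icc (-(r : ℤ)) N) fun j hj => ?_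
    rw [Finset.mem_Icc, not_and_or] at hj
    refine fwdDiff_iter_eq_zero fun i _ _ => ?_
    rcases hj with h | h
    · exact gφ0 i (by omega)
    · exact gφN i (by omega)
  have hsum : powSeq α = gφ + gc := by
    ext j; simp only [hgφ, hgc, Pi.add_apply]; push_cast; ring
  have hΔ : ∀ j, ((fwdDiff 1)^[r] gc) j =
      ((fwdDiff 1)^[r] (powSeq α)) j - ((fwdDiff 1)^[r] gφ) j := fun j => by
    rw [hsum, fwdDiff_iter_add]; simp
  have hps := summable_fwdDiff_iter_powSeq r (α := α) (by linarith)
  have hfin : ∑ j ∈ Finset.Ico 1 N, χ (j : ZMod q) * gφ (j : ℤ) =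
      ∑' j : ℤ, Ψ (j : ZMod q) * ((fwdDiff 1)^[r] gφ) j := by
    rw [← hΨ gφ gφs, tsum_int_eq_sum_Ico N]
    · simp
    · intro j hj; rw [gφ0 j hj, mul_zero]
    · intro j hj; rw [gφN j hj, mul_zero]
  -- The truncated part and `L(α, χ)` undergo the same summation by parts; their difference involves
  -- only the complementary part `gc`, whose differences are summable even where `gc` itself is not.
  have hdiff : ∑ j ∈ Finset.Ico 1 N, χ (j : ZMod q) * gφ (j : ℤ) - DirichletCharacter.LFunction χ α
      = -∑' j : ℤ, Ψ (j : ZMod q) * ((fwdDiff 1)^[r] gc) j := by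
    rw [hfin, ← LFunction_eq_tsum_fwdDiff_powSeq hχ hΨ (by linarith : 1 < α.re + r),
      ← (summable_periodic_mul Ψ gφΔ).tsum_sub (summable_periodic_mul Ψ hps), ← tsum_neg]
    exact tsum_congr fun j => by rw [hΔ]; ring
  have hscale : ∀ j : ℤ, 0 < j → powSeq α j = (N : ℂ) ^ (-α) * (((j / N : ℝ) : ℂ)) ^ (-α) := by
    intro j hj
    have hj' : (0 : ℝ) < j := by exact_mod_cast hj
    rw [powSeq, if_pos hj, ← Complex.ofReal_natCast,
      ← Complex.mul_cpow_ofReal_nonneg hN0.le (by positivity), ← Complex.ofReal_mul,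
      mul_div_cancel₀ _ hN0.ne', Complex.ofReal_intCast]
  have hgcG : gc = (N : ℂ) ^ (-α) • fun j : ℤ =>
      ((1 - smoothCutoff (j / N : ℝ) : ℝ) : ℂ) * (((j / N : ℝ) : ℂ)) ^ (-α) := by
    ext j
    simp only [hgc, Pi.smul_apply, smul_eq_mul]
    rcases lt_or_ge 0 j with hj | hj
    · rw [hscale j hj]; ring
    · have : (j / N : ℝ) ≤ 0 := div_nonpos_of_nonpos_of_nonneg (by exact_mod_cast hj) hN0.le
      rw [smoothCutoff_of_le (by linarith)]; simp
  set A : ℝ := (N : ℝ) ^ (-α.re) * (C * (N : ℝ)⁻¹ ^ r) with hA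
  have hA0 : 0 ≤ A := by positivity
  -- On `[-r, N]`, `gc` samples a fixed smooth function, scaled by `N^(-α)`; beyond `N` it coincides
  -- with `powSeq α`; for `j < -r` all values involved vanish.
  have hbound : ∀ j : ℤ, ‖((fwdDiff 1)^[r] gc) j‖ ≤
      (if j ∈ Finset.Icc (-(r : ℤ)) N then A else 0) +
        P * (N : ℝ) ^ (2 - α.re - r) * |(j : ℝ)| ^ (-2 : ℝ) := by
    intro j
    by_cases hj : j ∈ Finset.Icc (-(r : ℤ)) N
    · rw [if_pos hj]
      rw [Finset.mem_Icc] at hj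
      refine le_add_of_le_of_nonneg ?_ (by positivity)
      rw [hgcG, fwdDiff_iter_const_smul, Pi.smul_apply, norm_smul, ← Complex.ofReal_natCast,
        Complex.norm_cpow_eq_rpow_re_of_pos hN0, Complex.neg_re]
      exact mul_le_mul_of_nonneg_left (hC N hN j hj.1 hj.2) (by positivity)
    · rw [if_neg hj, zero_add]
      rw [Finset.mem_Icc, not_and_or] at hj
      rcases hj with h | h
      · rw [fwdDiff_iter_eq_zero, norm_zero]
        · positivity
        · intro i _ _
          simp only [hgc]
          rw [powSeq, if_neg (by omega), mul_zero]
      · have hjN : (N : ℤ) < j := by omega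
        have hjN' : (N : ℝ) ≤ j := by exact_mod_cast hjN.le
        have hj0 : (0 : ℝ) < j := by linarith
        rw [fwdDiff_iter_congr (g := powSeq α)]
        · refine (norm_fwdDiff_iter_powSeq_le r (by linarith) (by omega)).trans ?_
          rw [mul_assoc]
          refine mul_le_mul_of_nonneg_left ?_ hP0
          rw [abs_of_pos hj0, show -(α.re + r) = (2 - α.re - r) + (-2) by ring, Real.rpow_add hj0]
          exact mul_le_mul_of_nonneg_right
            (Real.rpow_le_rpow_of_nonpos hN0 hjN' (by linarith)) (by positivity)
        · intro i hi _
          simp only [hgc]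
          rw [cutN i (by omega)]; simp
  have hind : HasSum (fun j : ℤ => if j ∈ Finset.Icc (-(r : ℤ)) N then A else 0)
      ((N + r + 1) * A) := by
    have := hasSum_sum_of_ne_finset_zero (f := fun j : ℤ => if j ∈ Finset.Icc (-(r : ℤ)) N then A
      else 0) (s := Finset.Icc (-(r : ℤ)) N) (L := .unconditional ℤ) fun j hj => if_neg hj
    convert this using 1
    rw [Finset.sum_ite_mem, Finset.inter_self, Finset.sum_const, nsmul_eq_mul,
      Int.card_Icc_neg_natCast]
  have htot := (hind.add (hZs.hasSum.mul_left (P * (N : ℝ) ^ (2 - α.re - r)))).mul_left B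
  have hnorm : ‖∑' j : ℤ, Ψ (j : ZMod q) * ((fwdDiff 1)^[r] gc) j‖ ≤
      B * ((N + r + 1) * A + P * (N : ℝ) ^ (2 - α.re - r) * Z) := by
    refine tsum_of_norm_bounded htot fun j => ?_
    rw [norm_mul]
    exact mul_le_mul (hB _) (hbound j) (norm_nonneg _) hB0
  have hLHS : ∑ j ∈ Finset.Ico 1 N,
        χ (j : ZMod q) * ((smoothCutoff (j / N) : ℂ) * (((j / N : ℝ) : ℂ)) ^ (-α)) -
      DirichletCharacter.LFunction χ α * (N : ℂ) ^ α =
      (N : ℂ) ^ α * (∑ j ∈ Finset.Ico 1 N, χ (j : ZMod q) * gφ (j : ℤ) -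
        DirichletCharacter.LFunction χ α) := by
    rw [mul_sub, Finset.mul_sum, mul_comm (DirichletCharacter.LFunction χ α)]
    congr 1
    refine Finset.sum_congr rfl fun j hj => ?_
    simp only [hgφ]
    rw [hscale j (by have := (Finset.mem_Ico.mp hj).1; omega), Complex.cpow_neg (N : ℂ)]
    have : (N : ℂ) ^ α ≠ 0 := by simp [Complex.cpow_eq_zero_iff, hNc]
    field_simp
    simp
  have hAN : (N + r + 1) * A ≤ (r + 2) * C * (N : ℝ) ^ (2 - α.re - r) := by
    have hr0 : (0 : ℝ) ≤ r := Nat.cast_nonneg r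
    have e : (N : ℝ) * A = C * (N : ℝ) ^ (1 - α.re - r) := by
      rw [hA, sub_sub, sub_eq_add_neg, neg_add, Real.rpow_add hN0, Real.rpow_add hN0, Real.rpow_one,
        Real.rpow_neg hN0.le (r : ℝ), Real.rpow_natCast, inv_pow]
      ring
    calc (N + r + 1) * A ≤ ((r + 2) * N) * A :=
          mul_le_mul_of_nonneg_right (by nlinarith) hA0
      _ = (r + 2) * C * (N : ℝ) ^ (1 - α.re - r) := by rw [mul_assoc, e]; ring
      _ ≤ _ := by
          refine mul_le_mul_of_nonneg_left ?_ (by positivity)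
          exact Real.rpow_le_rpow_of_exponent_le hN' (by linarith)
  rw [hLHS, hdiff, norm_mul, norm_neg, ← Complex.ofReal_natCast,
    Complex.norm_cpow_eq_rpow_re_of_pos hN0, Real.norm_of_nonneg (by positivity)]
  have hZ0 : 0 ≤ Z := tsum_nonneg fun j => by positivity
  calc (N : ℝ) ^ α.re * _
      ≤ (N : ℝ) ^ α.re * (B * (((r + 2) * C + P * Z) * (N : ℝ) ^ (2 - α.re - r))) := by
        refine mul_le_mul_of_nonneg_left (hnorm.trans (mul_le_mul_of_nonneg_left ?_ hB0))
          (by positivity)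
        rw [add_mul]
        linarith
    _ = B * ((r + 2) * C + P * Z) * (N : ℝ) ^ (2 - r : ℝ) := by
        rw [show (2 - r : ℝ) = α.re + (2 - α.re - r) by ring, Real.rpow_add hN0]; ring
    _ ≤ _ := mul_le_mul_of_nonneg_left (Real.rpow_le_rpow_of_exponent_le hN' hrK) (by positivity)

/-! ### Taylor coefficients and remainders -/

/-- The factor `0 ^ t` covers two uses: `t = 0` reads off a leading coefficient, `t > 0` shows that
a higher-order term does not contribute. -/
theorem iteratedDeriv_pow_add_mul_zero (n t : ℕ) {g : ℂ → ℂ} (hg : AnalyticAt ℂ g 0) :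
    iteratedDeriv n (fun z => z ^ (n + t) * g z) 0 = n ! * (0 ^ t * g 0) := by
  induction n generalizing g with
  | zero => simp
  | succ n ih =>
    rw [iteratedDeriv_succ']
    have e : deriv (fun z => z ^ (n + 1 + t) * g z) =ᶠ[𝓝 0]
        fun z => z ^ (n + t) * ((n + t + 1) * g z + z * deriv g z) := by
      filter_upwards [hg.eventually_analyticAt] with z hz
      have h1 : HasDerivAt (fun z : ℂ => z ^ (n + t + 1)) ((n + t + 1 : ℕ) * z ^ (n + t)) z := by
        simpa using hasDerivAt_pow (n + t + 1) z
      have := (h1.mul hz.differentiableAt.hasDerivAt).deriv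
      rw [show n + 1 + t = n + t + 1 by ring]
      refine this.trans ?_
      push_cast; ring
    rw [e.iteratedDeriv_eq, ih (by fun_prop)]
    rcases Nat.eq_zero_or_pos t with rfl | ht
    · simp [Nat.factorial_succ]; ring
    · simp [ht.ne']

/-- Each step divides out one factor `z` with `dslope`, which preserves holomorphy on the ball; the
resulting identity is algebraic and so holds for all `z`. -/
theorem exists_taylor_remainder {R : ℝ} (hR : 0 < R) {f : ℂ → ℂ}
    (hf : DifferentiableOn ℂ f (Metric.ball 0 R)) (n : ℕ) :
    ∃ A : ℂ → ℂ, DifferentiableOn ℂ A (Metric.ball 0 R) ∧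
      ∀ z, f z = ∑ i ∈ Finset.range n, iteratedDeriv i f 0 / i ! * z ^ i + z ^ n * A z := by
  have hmem : Metric.ball (0 : ℂ) R ∈ 𝓝 (0 : ℂ) := Metric.ball_mem_nhds 0 hR
  induction n with
  | zero => exact ⟨f, hf, fun z => by simp⟩
  | succ n ih =>
    obtain ⟨A, hA, hfA⟩ := ih
    refine ⟨dslope A 0, (Complex.differentiableOn_dslope hmem).mpr hA, fun z => ?_⟩
    have hA0 : AnalyticAt ℂ A 0 := hA.analyticAt hmem
    have hcoef : iteratedDeriv n f 0 / n ! = A 0 := by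
      have hs : iteratedDeriv n (fun z : ℂ =>
          ∑ i ∈ Finset.range n, iteratedDeriv i f 0 / i ! * z ^ i) 0 = 0 := by
        rw [iteratedDeriv_fun_sum fun i _ => by fun_prop]
        refine Finset.sum_eq_zero fun i hi => ?_
        rw [iteratedDeriv_const_mul_field, iteratedDeriv_fun_pow_zero]
        simp [(Finset.mem_range.mp hi).ne']
      have hr : iteratedDeriv n (fun z => z ^ n * A z) 0 = n ! * A 0 := by
        simpa using iteratedDeriv_pow_add_mul_zero n 0 hA0
      have : iteratedDeriv n f 0 = n ! * A 0 := by
        conv_lhs => rw [funext hfA]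
        rw [iteratedDeriv_fun_add (by fun_prop)
          (AnalyticAt.contDiffAt (by fun_prop)), hs, hr, zero_add]
      rw [this, mul_div_cancel_left₀ _ (Nat.cast_ne_zero.mpr n.factorial_ne_zero)]
    have hd : A z = A 0 + z * dslope A 0 z := by
      have := sub_smul_dslope A 0 z
      simp only [sub_zero, smul_eq_mul] at this
      rw [this]; ring
    rw [hfA z, Finset.sum_range_succ, hcoef]
    rw [hd]; ring

theorem iteratedDeriv_odd_eq_zero {f : ℂ → ℂ} (hf : ∀ z, f (-z) = f z) {n : ℕ} (hn : Odd n) :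
    iteratedDeriv n f 0 = 0 := by
  have h := iteratedDeriv_comp_neg n f 0
  rw [funext hf, hn.neg_one_pow, neg_zero] at h
  simp only [neg_smul, one_smul] at h
  exact self_eq_neg.mp h

theorem exists_exp_taylor_remainder (n : ℕ) :
    ∃ E : ℂ → ℂ, AnalyticAt ℂ E 0 ∧
      ∀ z, Complex.exp z = ∑ i ∈ Finset.range n, z ^ i / i ! + z ^ n * E z := by
  obtain ⟨A, hA, h⟩ := exists_taylor_remainder one_pos Complex.differentiable_exp.differentiableOn n
  refine ⟨A, hA.analyticAt (Metric.ball_mem_nhds 0 one_pos), fun z => ?_⟩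
  rw [h z]
  congr 1
  refine Finset.sum_congr rfl fun i _ => ?_
  rw [iteratedDeriv_eq_iterate, Complex.iter_deriv_exp, Complex.exp_zero]
  ring

/-! ### The functions `sin w / w` and `log((z/2) / sin(z/2))` -/

/-- The entire function `sin w / w`. -/
noncomputable def csinc : ℂ → ℂ := dslope Complex.sin 0

theorem mul_csinc (w : ℂ) : w * csinc w = Complex.sin w := by
  simpa [csinc] using sub_smul_dslope Complex.sin 0 w

theorem csinc_zero : csinc 0 = 1 := by
  simp [csinc, dslope_same]

theorem csinc_of_ne_zero {w : ℂ} (hw : w ≠ 0) : csinc w = Complex.sin w / w := by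
  rw [← mul_csinc]; field_simp

theorem csinc_neg (w : ℂ) : csinc (-w) = csinc w := by
  rcases eq_or_ne w 0 with rfl | hw
  · simp
  · rw [csinc_of_ne_zero hw, csinc_of_ne_zero (neg_ne_zero.mpr hw), Complex.sin_neg, neg_div_neg_eq]

theorem differentiable_csinc : Differentiable ℂ csinc := differentiableOn_univ.mp
  ((Complex.differentiableOn_dslope univ_mem).mpr Complex.differentiable_sin.differentiableOn)

/-- Suppose `sin w = t w` with `t ≤ 0` and `w = a + ib`. Then `sin a cosh b = t a` has incompatible
signs if `0 < |a| < π`, and for `a = 0` the relation `sinh b = t b` forces `b = 0`. Hence the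
principal logarithm is holomorphic on the whole disc `‖z‖ < 2π`. -/
theorem csinc_mem_slitPlane {w : ℂ} (hw : ‖w‖ < Real.pi) : csinc w ∈ Complex.slitPlane := by
  rcases eq_or_ne w 0 with rfl | hw0
  · simp [csinc_zero]
  by_contra hmem
  rw [Complex.mem_slitPlane_iff_not_le_zero, not_not] at hmem
  obtain ⟨t, ht, hts⟩ : ∃ t : ℝ, t ≤ 0 ∧ csinc w = t := by
    refine ⟨(csinc w).re, (Complex.le_def.mp hmem).1, ?_⟩
    exact Complex.ext rfl (by simpa using (Complex.le_def.mp hmem).2)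
  have hsin : Complex.sin w = w * t := by rw [← mul_csinc, hts]
  have hre := congrArg Complex.re hsin
  have him := congrArg Complex.im hsin
  rw [Complex.sin_eq] at hre him
  simp only [← Complex.ofReal_sin, ← Complex.ofReal_cos, ← Complex.ofReal_cosh,
    ← Complex.ofReal_sinh, Complex.add_re, Complex.add_im, Complex.mul_re, Complex.mul_im,
    Complex.ofReal_re, Complex.ofReal_im, Complex.I_re, Complex.I_im] at hre him
  ring_nf at hre him
  have habs : |w.re| < Real.pi := (Complex.abs_re_le_norm w).trans_lt hw
  rw [abs_lt] at habs
  have hcosh := Real.cosh_pos w.im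
  rcases lt_trichotomy w.re 0 with h | h | h
  · have h1 : Real.sin w.re < 0 := Real.sin_neg_of_neg_of_neg_pi_lt h habs.1
    nlinarith [mul_neg_of_neg_of_pos h1 hcosh, mul_nonneg_of_nonpos_of_nonpos h.le ht]
  · rw [h, Real.cos_zero] at him
    rcases lt_trichotomy w.im 0 with h' | h' | h'
    · have := Real.sinh_neg_iff.mpr h'
      nlinarith [mul_nonneg_of_nonpos_of_nonpos h'.le ht]
    · exact hw0 (Complex.ext h h')
    · have := Real.sinh_pos_iff.mpr h'
      nlinarith [mul_nonpos_of_nonneg_of_nonpos h'.le ht]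
  · have h1 : 0 < Real.sin w.re := Real.sin_pos_of_pos_of_lt_pi h habs.2
    nlinarith [mul_pos h1 hcosh, mul_nonpos_of_nonneg_of_nonpos h.le ht]

theorem exists_csinc_eq_one_add :
    ∃ τ : ℂ → ℂ, Differentiable ℂ τ ∧ τ 0 = -1 / 6 ∧ ∀ w, csinc w = 1 + w ^ 2 * τ w := by
  have hd1 : Differentiable ℂ (dslope csinc 0) := differentiableOn_univ.mp
    ((Complex.differentiableOn_dslope univ_mem).mpr differentiable_csinc.differentiableOn)
  have hd2 : Differentiable ℂ (dslope (dslope csinc 0) 0) := differentiableOn_univ.mp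
    ((Complex.differentiableOn_dslope univ_mem).mpr hd1.differentiableOn)
  have h0 : dslope csinc 0 0 = 0 := by
    rw [dslope_same]
    simpa using iteratedDeriv_odd_eq_zero csinc_neg (n := 1) odd_one
  have heq : ∀ w, csinc w = 1 + w ^ 2 * dslope (dslope csinc 0) 0 w := by
    intro w
    have h1 := sub_smul_dslope csinc 0 w
    have h2 := sub_smul_dslope (dslope csinc 0) 0 w
    simp only [sub_zero, smul_eq_mul, csinc_zero, h0] at h1 h2
    rw [pow_two, mul_assoc, h2, h1]; ring
  refine ⟨_, hd2, ?_, heq⟩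
  -- The value at `0` is found as a limit, from `|sin w - (w - w³/6)| ≤ |w|⁵/100`.
  refine tendsto_nhds_unique (hd2.continuous.continuousAt.mono_left nhdsWithin_le_nhds :
    Tendsto _ (𝓝[≠] (0 : ℂ)) _) ?_
  rw [tendsto_iff_norm_sub_tendsto_zero]
  have hlim : Tendsto (fun w : ℂ => ‖w‖ ^ 2 / 100) (𝓝[≠] 0) (𝓝 0) := by
    have : Continuous fun w : ℂ => ‖w‖ ^ 2 / 100 := by fun_prop
    simpa using (this.tendsto 0).mono_left nhdsWithin_le_nhds
  refine squeeze_zero' (Eventually.of_forall fun _ => norm_nonneg _) ?_ hlim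
  filter_upwards [self_mem_nhdsWithin,
    mem_nhdsWithin_of_mem_nhds (Metric.ball_mem_nhds (0 : ℂ) one_pos)] with w hw hw1
  have hw0 : w ≠ 0 := hw
  have hb := Complex.sin_bound (x := w) (by simpa using (mem_ball_zero_iff.mp hw1).le)
  have hs := mul_csinc w
  rw [heq w] at hs
  have e : Complex.sin w - (w - w ^ 3 / 6) =
      w ^ 3 * (dslope (dslope csinc 0) 0 w - -1 / 6) := by rw [← hs]; ring
  rw [e, norm_mul, norm_pow] at hb
  have hpos : 0 < ‖w‖ := norm_pos_iff.mpr hw0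
  have : ‖w‖ ^ 3 * ‖dslope (dslope csinc 0) 0 w - -1 / 6‖ ≤ ‖w‖ ^ 3 * (‖w‖ ^ 2 / 100) := by
    refine hb.trans (le_of_eq ?_); ring
  exact le_of_mul_le_mul_left this (by positivity)

/-- The function `log ((z / 2) / sin (z / 2))`. -/
noncomputable def logInvSinc (z : ℂ) : ℂ := -Complex.log (csinc (z / 2))

/-- The double zero bounds the degree of `b_k` by `k`; `l 0 = 1/24 ≠ 0` makes the degree exact. -/
theorem exists_logInvSinc_eq_sq_mul :
    ∃ l : ℂ → ℂ, AnalyticAt ℂ l 0 ∧ l 0 ≠ 0 ∧ ∀ z, logInvSinc z = z ^ 2 * l z := by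
  obtain ⟨τ, hτ, hτ0, hs⟩ := exists_csinc_eq_one_add
  set Λ : ℂ → ℂ := dslope (fun x => Complex.log (1 + x)) 0 with hΛ
  have hder : HasDerivAt (fun x : ℂ => Complex.log (1 + x)) 1 0 := by
    have := ((hasDerivAt_id (0 : ℂ)).const_add 1).clog (by simp)
    simpa using this
  have hΛ0 : Λ 0 = 1 := by rw [hΛ, dslope_same, hder.deriv]
  have hmem : Metric.ball (0 : ℂ) 1 ∈ 𝓝 (0 : ℂ) := Metric.ball_mem_nhds 0 one_pos
  have hΛa : AnalyticAt ℂ Λ 0 := by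
    refine DifferentiableOn.analyticAt ((Complex.differentiableOn_dslope hmem).mpr ?_) hmem
    intro x hx
    have : 1 + x ∈ Complex.slitPlane := Complex.mem_slitPlane_of_norm_lt_one (by simpa using hx)
    exact (((differentiableAt_id).const_add 1).clog this).differentiableWithinAt
  have hlog : ∀ x, Complex.log (1 + x) = x * Λ x := by
    intro x
    have := sub_smul_dslope (fun x => Complex.log (1 + x)) 0 x
    simp only [sub_zero, smul_eq_mul, add_zero, Complex.log_one] at this
    exact this.symm
  refine ⟨fun z => -(1 / 4) * τ (z / 2) * Λ ((z / 2) ^ 2 * τ (z / 2)), ?_, ?_, fun z => ?_⟩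
  · have h1 : AnalyticAt ℂ (fun z : ℂ => τ (z / 2)) 0 :=
      (hτ.comp (differentiable_id.div_const 2)).analyticAt 0
    have h2 : AnalyticAt ℂ (fun z : ℂ => (z / 2) ^ 2 * τ (z / 2)) 0 :=
      AnalyticAt.mul (by fun_prop) h1
    have h3 : AnalyticAt ℂ (fun z : ℂ => Λ ((z / 2) ^ 2 * τ (z / 2))) 0 :=
      AnalyticAt.fun_comp (by simpa using hΛa) h2
    exact (analyticAt_const.mul h1).mul h3
  · simp [hΛ0, hτ0]
  · rw [logInvSinc, hs, hlog]; ring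

/-! ### The generating function and the polynomials `b_k` -/

/-- The function `z cot (z / 2)`. -/
noncomputable def mulCotHalf (z : ℂ) : ℂ := 2 * Complex.cos (z / 2) / csinc (z / 2)

/-- The even function `z ((z / 2) / sin (z / 2)) ^ (2 s) cot (z / 2)`, extended over `z = 0`. -/
noncomputable def cotPow (s z : ℂ) : ℂ := mulCotHalf z * Complex.exp (2 * s * logInvSinc z)

theorem mulCotHalf_neg (z : ℂ) : mulCotHalf (-z) = mulCotHalf z := by
  simp [mulCotHalf, neg_div, csinc_neg]

theorem cotPow_neg (s z : ℂ) : cotPow s (-z) = cotPow s z := by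
  rw [cotPow, mulCotHalf_neg]
  simp [cotPow, logInvSinc, neg_div, csinc_neg]

theorem csinc_half_mem_slitPlane {z : ℂ} (hz : ‖z‖ < 2 * Real.pi) :
    csinc (z / 2) ∈ Complex.slitPlane :=
  csinc_mem_slitPlane (by rw [norm_div, Complex.norm_ofNat]; linarith)

theorem differentiableAt_mulCotHalf {z : ℂ} (hz : ‖z‖ < 2 * Real.pi) :
    DifferentiableAt ℂ mulCotHalf z := by
  have h1 : DifferentiableAt ℂ (fun z : ℂ => csinc (z / 2)) z :=
    (differentiable_csinc.comp (differentiable_id.div_const 2)) z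
  have h2 : DifferentiableAt ℂ (fun z : ℂ => 2 * Complex.cos (z / 2)) z := by fun_prop
  exact h2.div h1 (Complex.slitPlane_ne_zero (csinc_half_mem_slitPlane hz))

theorem differentiableAt_logInvSinc {z : ℂ} (hz : ‖z‖ < 2 * Real.pi) :
    DifferentiableAt ℂ logInvSinc z := by
  have h1 : DifferentiableAt ℂ (fun z : ℂ => csinc (z / 2)) z :=
    (differentiable_csinc.comp (differentiable_id.div_const 2)) z
  exact (h1.clog (csinc_half_mem_slitPlane hz)).neg

theorem differentiableOn_cotPow (s : ℂ) :
    DifferentiableOn ℂ (cotPow s) (Metric.ball 0 (2 * Real.pi)) := fun z hz => by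
  have hz' : ‖z‖ < 2 * Real.pi := by simpa using hz
  exact ((differentiableAt_mulCotHalf hz').mul
    ((differentiableAt_logInvSinc hz').const_mul (2 * s)).cexp).differentiableWithinAt

theorem cpow_mul_cot_eq_cotPow (s : ℂ) {z : ℂ} (hz0 : z ≠ 0) (hz : ‖z‖ < 2 * Real.pi) :
    ((z / 2) / Complex.sin (z / 2)) ^ (2 * s) * Complex.cot (z / 2) = cotPow s z / z := by
  have hsl := csinc_half_mem_slitPlane hz
  have hne := Complex.slitPlane_ne_zero hsl
  have h2 : z / 2 ≠ 0 := div_ne_zero hz0 two_ne_zero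
  have e : (z / 2) / Complex.sin (z / 2) = (csinc (z / 2))⁻¹ := by
    rw [← mul_csinc]; field_simp
  rw [e, Complex.cpow_def_of_ne_zero (inv_ne_zero hne), Complex.log_inv _
    (Complex.slitPlane_arg_ne_pi hsl), Complex.cot, ← mul_csinc, cotPow, mulCotHalf, logInvSinc]
  rw [mul_comm (-Complex.log _)]
  field_simp

/-- The polynomials `b_k` of the Laurent expansion of `((z / 2) / sin (z / 2)) ^ (2 s) cot (z / 2)`:
the coefficient of `z ^ (2 k)` in the power series of `cotPow s`. -/
noncomputable def cotPoly (k : ℕ) : Polynomial ℂ :=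
  ∑ i ∈ Finset.range (k + 1), Polynomial.monomial i
    (2 ^ i / i ! * (iteratedDeriv (2 * k) (fun z => logInvSinc z ^ i * mulCotHalf z) 0 / (2 * k)!))

theorem analyticAt_mulCotHalf : AnalyticAt ℂ mulCotHalf 0 := by
  have hmem : Metric.ball (0 : ℂ) (2 * Real.pi) ∈ 𝓝 (0 : ℂ) :=
    Metric.ball_mem_nhds 0 Real.two_pi_pos
  exact DifferentiableOn.analyticAt (fun z hz =>
    (differentiableAt_mulCotHalf (by simpa using hz)).differentiableWithinAt) hmem

theorem analyticAt_logInvSinc : AnalyticAt ℂ logInvSinc 0 := by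
  have hmem : Metric.ball (0 : ℂ) (2 * Real.pi) ∈ 𝓝 (0 : ℂ) :=
    Metric.ball_mem_nhds 0 Real.two_pi_pos
  exact DifferentiableOn.analyticAt (fun z hz =>
    (differentiableAt_logInvSinc (by simpa using hz)).differentiableWithinAt) hmem

/-- Expand `exp(2 s logInvSinc z)` to order `k`: what is left is divisible by `z^(2k+2)` and does
not affect the `2k`-th derivative at `0`. -/
theorem eval_cotPoly (k : ℕ) (s : ℂ) :
    (cotPoly k).eval s = iteratedDeriv (2 * k) (cotPow s) 0 / (2 * k)! := by
  obtain ⟨l, hl, -, hlog⟩ := exists_logInvSinc_eq_sq_mul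
  obtain ⟨E, hE, hexp⟩ := exists_exp_taylor_remainder (k + 1)
  have hL := analyticAt_logInvSinc
  have hC := analyticAt_mulCotHalf
  have hL0 : logInvSinc 0 = 0 := by rw [hlog]; simp
  have hEa : AnalyticAt ℂ (fun z => E (2 * s * logInvSinc z)) 0 :=
    AnalyticAt.fun_comp (by simpa [hL0] using hE) (analyticAt_const.mul hL)
  have hdec : cotPow s = fun z => (∑ i ∈ Finset.range (k + 1),
      ((2 * s) ^ i / i !) * (logInvSinc z ^ i * mulCotHalf z)) + z ^ (2 * k + 2) *
        ((2 * s) ^ (k + 1) * l z ^ (k + 1) * E (2 * s * logInvSinc z) * mulCotHalf z) := by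
    ext z
    rw [cotPow, hexp, mul_add, Finset.mul_sum]
    congr 1
    · exact Finset.sum_congr rfl fun i _ => by rw [mul_pow]; ring
    · have : logInvSinc z ^ (k + 1) = z ^ (2 * k + 2) * l z ^ (k + 1) := by
        rw [hlog, mul_pow, ← pow_mul, mul_add, mul_one]
      rw [mul_pow, this]; ring
  have hrem : AnalyticAt ℂ (fun z => (2 * s) ^ (k + 1) * l z ^ (k + 1) *
      E (2 * s * logInvSinc z) * mulCotHalf z) 0 :=
    ((analyticAt_const.mul (hl.pow _)).mul hEa).mul hC
  have hterm : ∀ i, AnalyticAt ℂ (fun z => logInvSinc z ^ i * mulCotHalf z) 0 :=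
    fun i => (hL.pow i).mul hC
  rw [hdec, iteratedDeriv_fun_add, iteratedDeriv_pow_add_mul_zero _ _ hrem, iteratedDeriv_fun_sum]
  · simp only [iteratedDeriv_const_mul_field, cotPoly, Polynomial.eval_finsetSum,
      Polynomial.eval_monomial]
    rw [zero_pow two_ne_zero, zero_mul, mul_zero, add_zero, Finset.sum_div]
    exact Finset.sum_congr rfl fun i _ => by rw [mul_pow]; ring
  · exact fun i _ => (analyticAt_const.mul (hterm i)).contDiffAt
  · exact (Finset.analyticAt_fun_sum _ fun i _ => analyticAt_const.mul (hterm i)).contDiffAt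
  · exact ((analyticAt_id.pow _).mul hrem).contDiffAt

theorem degree_cotPoly (k : ℕ) : (cotPoly k).degree = (k : WithBot ℕ) := by
  obtain ⟨l, hl, hl0, hlog⟩ := exists_logInvSinc_eq_sq_mul
  have hfac : ∀ n : ℕ, (n ! : ℂ) ≠ 0 := fun n => Nat.cast_ne_zero.mpr n.factorial_ne_zero
  refine Polynomial.degree_eq_of_le_of_coeff_ne_zero ?_ ?_
  · refine (Polynomial.degree_sum_le _ _).trans (Finset.sup_le fun i hi => ?_)
    exact (Polynomial.degree_monomial_le _ _).trans
      (by exact_mod_cast Nat.lt_succ_iff.mp (Finset.mem_range.mp hi))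
  -- The leading coefficient comes out as `2^k / k! · l(0)^k · 2`.
  · have hcoeff : (cotPoly k).coeff k = 2 ^ k / k ! *
        (iteratedDeriv (2 * k) (fun z => logInvSinc z ^ k * mulCotHalf z) 0 / (2 * k)!) := by
      simp [cotPoly, Polynomial.finsetSum_coeff, Polynomial.coeff_monomial]
    have hfun : (fun z => logInvSinc z ^ k * mulCotHalf z) =
        fun z => z ^ (2 * k + 0) * (l z ^ k * mulCotHalf z) := by
      ext z; rw [hlog, mul_pow, ← pow_mul]; ring
    have h0 : mulCotHalf 0 = 2 := by simp [mulCotHalf, csinc_zero]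
    have han : AnalyticAt ℂ (fun z => l z ^ k * mulCotHalf z) 0 :=
      (hl.pow k).mul analyticAt_mulCotHalf
    rw [hcoeff, hfun, iteratedDeriv_pow_add_mul_zero _ _ han, h0]
    have := hfac k
    have := hfac (2 * k)
    have := pow_ne_zero k hl0
    simp [*]

theorem hasSum_cotPow (s : ℂ) {z : ℂ} (hz : ‖z‖ < 2 * Real.pi) :
    HasSum (fun k : ℕ => (cotPoly k).eval s * z ^ (2 * k)) (cotPow s z) := by
  have h := Complex.hasSum_taylorSeries_on_ball (differentiableOn_cotPow s)
    (mem_ball_zero_iff.mpr hz)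
  have hinj : Function.Injective fun k : ℕ => 2 * k := fun a b h => by simpa using h
  rw [← hinj.hasSum_iff] at h
  · have e : (fun k : ℕ => (cotPoly k).eval s * z ^ (2 * k)) =
        (fun n : ℕ => (n ! : ℂ)⁻¹ • (z - 0) ^ n • iteratedDeriv n (cotPow s) 0) ∘ fun k => 2 * k := by
      ext k
      simp only [Function.comp_apply, eval_cotPoly, smul_eq_mul, sub_zero]
      ring
    rw [e]
    exact h
  · intro n hn
    have hodd : Odd n := by
      rw [← Nat.not_even_iff_odd]
      rintro ⟨m, rfl⟩
      exact hn ⟨m, by ring⟩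
    rw [iteratedDeriv_odd_eq_zero (cotPow_neg s) hodd]; simp

theorem hasSum_cotPoly (s : ℂ) {z : ℂ} (hz0 : 0 < ‖z‖) (hz : ‖z‖ < 2 * Real.pi) :
    HasSum (fun k : ℕ => (cotPoly k).eval s * z ^ (2 * (k : ℤ) - 1))
      (((z / 2) / Complex.sin (z / 2)) ^ (2 * s) * Complex.cot (z / 2)) := by
  have hne : z ≠ 0 := norm_pos_iff.mp hz0
  rw [cpow_mul_cot_eq_cotPow s hne hz]
  have e : (fun k : ℕ => (cotPoly k).eval s * z ^ (2 * (k : ℤ) - 1)) =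
      fun k : ℕ => (cotPoly k).eval s * z ^ (2 * k) / z := by
    ext k
    rw [zpow_sub_one₀ hne, mul_div_assoc, div_eq_mul_inv]
    norm_cast
  rw [e]
  exact (hasSum_cotPow s hz).div_const z

theorem exists_cotPow_remainder (s : ℂ) (M : ℕ) :
    ∃ A : ℂ → ℂ, DifferentiableOn ℂ A (Metric.ball 0 (2 * Real.pi)) ∧
      ∀ z, cotPow s z = ∑ k ∈ Finset.range M, (cotPoly k).eval s * z ^ (2 * k) +
        z ^ (2 * M) * A z := by
  obtain ⟨A, hA, h⟩ := exists_taylor_remainder Real.two_pi_pos (differentiableOn_cotPow s) (2 * M)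
  refine ⟨A, hA, fun z => ?_⟩
  rw [h z]
  congr 1
  clear h
  induction M with
  | zero => simp
  | succ M ih =>
    rw [show 2 * (M + 1) = 2 * M + 1 + 1 by ring, Finset.sum_range_succ, Finset.sum_range_succ,
      Finset.sum_range_succ, ih, eval_cotPoly,
      iteratedDeriv_odd_eq_zero (cotPow_neg s) (odd_two_mul_add_one M)]
    simp

/-! ### Smoothness of the Taylor remainder -/

/-- The function `x ↦ x ^ β` on `(0, ∞)`, extended by zero to the nonpositive reals. -/
noncomputable def posPow (β : ℂ) (x : ℝ) : ℂ := if 0 < x then (x : ℂ) ^ β else 0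

theorem posPow_of_pos (β : ℂ) {x : ℝ} (hx : 0 < x) : posPow β x = (x : ℂ) ^ β := if_pos hx

theorem posPow_of_nonpos (β : ℂ) {x : ℝ} (hx : x ≤ 0) : posPow β x = 0 := if_neg hx.not_gt

theorem norm_posPow_le (β : ℂ) (x : ℝ) : ‖posPow β x‖ ≤ |x| ^ β.re := by
  rcases lt_or_ge 0 x with hx | hx
  · rw [posPow_of_pos β hx, Complex.norm_cpow_eq_rpow_re_of_pos hx, abs_of_pos hx]
  · rw [posPow_of_nonpos β hx, norm_zero]; positivity

theorem hasDerivAt_posPow_of_ne_zero (β : ℂ) {x : ℝ} (hx : x ≠ 0) :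
    HasDerivAt (posPow β) (β * posPow (β - 1) x) x := by
  rcases lt_or_gt_of_ne hx with h | h
  · rw [posPow_of_nonpos _ h.le, mul_zero]
    refine (hasDerivAt_const x (0 : ℂ)).congr_of_eventuallyEq ?_
    filter_upwards [Iio_mem_nhds h] with y hy using posPow_of_nonpos β (le_of_lt hy)
  · rw [posPow_of_pos _ h]
    refine (hasDerivAt_ofReal_cpow_of_pos h β).congr_of_eventuallyEq ?_
    filter_upwards [Ioi_mem_nhds h] with y hy using posPow_of_pos β hy

theorem continuous_posPow {β : ℂ} (hβ : 0 < β.re) : Continuous (posPow β) := by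
  rw [continuous_iff_continuousAt]
  intro x
  rcases eq_or_ne x 0 with rfl | hx
  · rw [ContinuousAt, posPow_of_nonpos β le_rfl]
    refine squeeze_zero_norm (norm_posPow_le β) ?_
    have : ContinuousAt (fun x : ℝ => |x| ^ β.re) 0 :=
      (continuous_abs.continuousAt).rpow_const (Or.inr hβ.le)
    simpa [ContinuousAt, Real.zero_rpow hβ.ne'] using this
  · exact (hasDerivAt_posPow_of_ne_zero β hx).continuousAt

theorem hasDerivAt_posPow {β : ℂ} (hβ : 1 < β.re) (x : ℝ) :
    HasDerivAt (posPow β) (β * posPow (β - 1) x) x := by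
  rcases eq_or_ne x 0 with rfl | hx
  · rw [posPow_of_nonpos _ le_rfl, mul_zero, hasDerivAt_iff_isLittleO]
    simp only [posPow_of_nonpos β le_rfl, sub_zero, smul_zero]
    have h1 : posPow β =O[𝓝 0] fun x : ℝ => |x| ^ (β.re - 1) * |x| := by
      refine IsBigO.of_bound 1 (Eventually.of_forall fun x => ?_)
      rw [one_mul, Real.norm_of_nonneg (by positivity)]
      refine (norm_posPow_le β x).trans (le_of_eq ?_)
      rcases eq_or_ne x 0 with rfl | hx
      · rw [abs_zero, mul_zero, Real.zero_rpow (by linarith)]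
      · rw [Real.rpow_sub_one (abs_ne_zero.mpr hx), div_mul_cancel₀ _ (abs_ne_zero.mpr hx)]
    refine h1.trans_isLittleO ?_
    have h2 : Tendsto (fun x : ℝ => |x| ^ (β.re - 1)) (𝓝 0) (𝓝 0) := by
      have : ContinuousAt (fun x : ℝ => |x| ^ (β.re - 1)) 0 :=
        (continuous_abs.continuousAt).rpow_const (Or.inr (by linarith))
      simpa [ContinuousAt, Real.zero_rpow (by linarith : β.re - 1 ≠ 0)] using this
    have h3 := ((isLittleO_one_iff ℝ).mpr h2).mul_isBigO
      (isBigO_refl (fun x : ℝ => |x|) (𝓝 0))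
    simpa using h3.trans_isBigO (by simpa using (isBigO_refl (fun x : ℝ => x) (𝓝 0)).norm_left)
  · exact hasDerivAt_posPow_of_ne_zero β hx

/-- Each derivative lowers the exponent by one; as long as its real part stays positive, the
extension by zero is continuous at `0`. -/
theorem contDiff_posPow {n : ℕ} {β : ℂ} (hβ : (n : ℝ) < β.re) : ContDiff ℝ n (posPow β) := by
  induction n generalizing β with
  | zero => exact contDiff_zero.mpr (continuous_posPow (by simpa using hβ))
  | succ n ih =>
    push_cast at hβ
    have h1 : 1 < β.re := by linarith [(Nat.cast_nonneg n : (0 : ℝ) ≤ n)]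
    have hd : deriv (posPow β) = fun x => β * posPow (β - 1) x :=
      funext fun x => (hasDerivAt_posPow h1 x).deriv
    push_cast
    rw [contDiff_succ_iff_deriv]
    refine ⟨fun x => (hasDerivAt_posPow h1 x).differentiableAt, by simp, ?_⟩
    rw [hd]
    exact contDiff_const.mul (ih (by simp; linarith))

/-- `A` is holomorphic only for `|x| < 1`, so both sides are cut off. The second factor equals `1`
for `x ≥ 0` and costs nothing where `posPow` lives. -/
theorem contDiff_cutoff_mul_comp {A : ℂ → ℂ}
    (hA : DifferentiableOn ℂ A (Metric.ball 0 (2 * Real.pi))) (n : ℕ) :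
    ContDiff ℝ n fun x : ℝ =>
      ((smoothCutoff x * smoothCutoff (-x) : ℝ) : ℂ) * A ((2 * Real.pi * x : ℝ) : ℂ) := by
  rw [contDiff_iff_contDiffAt]
  intro x
  rcases lt_or_ge |x| 1 with hx | hx
  · refine ContDiffAt.mul ?_ ?_
    · exact Complex.ofRealCLM.contDiff.contDiffAt.comp x
        ((contDiff_smoothCutoff (n := n)).contDiffAt.mul
          ((contDiff_smoothCutoff (n := n)).comp contDiff_neg).contDiffAt)
    · have hmem : ((2 * Real.pi * x : ℝ) : ℂ) ∈ Metric.ball (0 : ℂ) (2 * Real.pi) := by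
        rw [mem_ball_zero_iff, Complex.norm_real, Real.norm_eq_abs, abs_mul,
          abs_of_pos Real.two_pi_pos]
        nlinarith [Real.two_pi_pos]
      have h1 : AnalyticAt ℂ A ((2 * Real.pi * x : ℝ) : ℂ) :=
        hA.analyticAt (Metric.isOpen_ball.mem_nhds hmem)
      have h2 : ContDiffAt ℝ n (fun x : ℝ => ((2 * Real.pi * x : ℝ) : ℂ)) x :=
        Complex.ofRealCLM.contDiff.contDiffAt.comp x (contDiffAt_const.mul contDiffAt_id)
      exact ((h1.contDiffAt (n := n)).restrict_scalars ℝ).comp x h2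
  · have hev : ∀ᶠ y : ℝ in 𝓝 x, 2 / 3 < |y| :=
      continuous_abs.continuousAt.eventually (lt_mem_nhds (by linarith))
    refine (contDiffAt_const (c := (0 : ℂ))).congr_of_eventuallyEq ?_
    filter_upwards [hev] with y hy
    have : smoothCutoff y * smoothCutoff (-y) = 0 := by
      rcases lt_abs.mp hy with h | h
      · rw [smoothCutoff_of_ge h.le, zero_mul]
      · rw [smoothCutoff_of_ge h.le, mul_zero]
    rw [this]; simp

/-! ### The summand: local expansion and reflection -/

/-- The summand `cot (π x) / (4 sin² (π x)) ^ s`. -/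
noncomputable def cotSummand (s : ℂ) (x : ℝ) : ℂ :=
  ((Real.cot (Real.pi * x) : ℝ) : ℂ) / ((4 * Real.sin (Real.pi * x) ^ 2 : ℝ) : ℂ) ^ s

theorem cotSummand_one_sub (s : ℂ) (x : ℝ) : cotSummand s (1 - x) = -cotSummand s x := by
  have e : Real.pi * (1 - x) = Real.pi - Real.pi * x := by ring
  rw [cotSummand, cotSummand, e, Real.cot_eq_cos_div_sin, Real.cot_eq_cos_div_sin,
    Real.cos_pi_sub, Real.sin_pi_sub]
  push_cast
  ring

/-- On `(0, 1)` both `2πx` and `2 sin(πx)` are positive, so the complex powers factor without branch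
corrections. -/
theorem cotSummand_eq_cotPow (s : ℂ) {x : ℝ} (hx0 : 0 < x) (hx1 : x < 1) :
    cotSummand s x = ((2 * Real.pi * x : ℝ) : ℂ) ^ (-(1 + 2 * s)) *
      cotPow s ((2 * Real.pi * x : ℝ) : ℂ) := by
  have hz : (0 : ℝ) < 2 * Real.pi * x := mul_pos Real.two_pi_pos hx0
  have hsin : 0 < Real.sin (Real.pi * x) :=
    Real.sin_pos_of_pos_of_lt_pi (mul_pos Real.pi_pos hx0) (by nlinarith [Real.pi_pos])
  set z : ℝ := 2 * Real.pi * x with hzdef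
  have hzc : (z : ℂ) ≠ 0 := by exact_mod_cast hz.ne'
  have hnorm : ‖(z : ℂ)‖ < 2 * Real.pi := by
    rw [Complex.norm_real, Real.norm_of_nonneg hz.le]
    nlinarith [Real.two_pi_pos]
  have key := cpow_mul_cot_eq_cotPow s hzc hnorm
  have hhalf : (z : ℂ) / 2 = ((Real.pi * x : ℝ) : ℂ) := by rw [hzdef]; push_cast; ring
  set S : ℝ := 2 * Real.sin (Real.pi * x) with hS
  have hS0 : 0 < S := by positivity
  have hSc : (S : ℂ) ≠ 0 := by exact_mod_cast hS0.ne'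
  have e1 : (z : ℂ) / 2 / Complex.sin (z / 2) = (z : ℂ) * ((S⁻¹ : ℝ) : ℂ) := by
    rw [hhalf, ← Complex.ofReal_sin, hS, hzdef]
    have : (Real.sin (Real.pi * x) : ℂ) ≠ 0 := by exact_mod_cast hsin.ne'
    push_cast
    push_cast at this
    field_simp
  have e2 : ((4 * Real.sin (Real.pi * x) ^ 2 : ℝ) : ℂ) ^ s = (S : ℂ) ^ (2 * s) := by
    have : 4 * Real.sin (Real.pi * x) ^ 2 = S * S := by rw [hS]; ring
    rw [this, Complex.ofReal_mul, Complex.mul_cpow_ofReal_nonneg hS0.le hS0.le, two_mul,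
      Complex.cpow_add _ _ hSc]
  have e3 : Complex.cot (z / 2) = ((Real.cot (Real.pi * x) : ℝ) : ℂ) := by
    rw [hhalf, Complex.ofReal_cot]
  have e4 : ((S⁻¹ : ℝ) : ℂ) ^ (2 * s) = ((S : ℂ) ^ (2 * s))⁻¹ := by
    rw [Complex.ofReal_inv, Complex.inv_cpow]
    rw [Complex.arg_ofReal_of_nonneg hS0.le]
    exact Real.pi_pos.ne
  have hzs : (z : ℂ) ^ (2 * s) ≠ 0 := by simp [Complex.cpow_eq_zero_iff, hzc]
  rw [e1, e3, Complex.mul_cpow_ofReal_nonneg hz.le (by positivity), e4] at key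
  have key' : cotPow s (z : ℂ) = z * ((z : ℂ) ^ (2 * s) * ((S : ℂ) ^ (2 * s))⁻¹ *
      ((Real.cot (Real.pi * x) : ℝ) : ℂ)) := by rw [key]; field_simp
  rw [cotSummand, e2, key', Complex.cpow_neg, Complex.cpow_add _ _ hzc, Complex.cpow_one]
  field_simp

theorem sum_odd_mul_cotSummand {q : ℕ} [NeZero q] {χ : DirichletCharacter ℂ q} (hχ : χ.Odd)
    (s : ℂ) {N : ℕ} (hN : q ∣ N) :
    ∑ j ∈ Finset.Ico 1 N, χ (j : ZMod q) * cotSummand s (j / N) =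
      2 * ∑ j ∈ Finset.Ico 1 N, χ (j : ZMod q) *
        ((smoothCutoff (j / N) : ℂ) * cotSummand s (j / N)) := by
  have hrefl : ∑ j ∈ Finset.Ico 1 N, χ (j : ZMod q) *
        ((smoothCutoff (1 - j / N) : ℂ) * cotSummand s (j / N)) =
      ∑ j ∈ Finset.Ico 1 N, χ (j : ZMod q) *
        ((smoothCutoff (j / N) : ℂ) * cotSummand s (j / N)) := by
    refine Finset.sum_nbij' (fun j => N - j) (fun j => N - j) ?_ ?_ ?_ ?_ ?_ <;>
      simp only [Finset.mem_Ico] <;> intro j hj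
    · omega
    · omega
    · omega
    · omega
    · have hN0 : (N : ℝ) ≠ 0 := by
        have : N ≠ 0 := by omega
        exact_mod_cast this
      have e1 : (((N - j : ℕ) : ℝ)) / N = 1 - j / N := by
        rw [Nat.cast_sub (by omega)]; field_simp
      have e2 : (((N - j : ℕ) : ZMod q)) = -(j : ZMod q) := by
        rw [Nat.cast_sub (by omega), (ZMod.natCast_eq_zero_iff N q).mpr hN, zero_sub]
      rw [e1, e2, hχ.eval_neg, cotSummand_one_sub]
      ring
  rw [two_mul]
  nth_rewrite 2 [← hrefl]
  rw [← Finset.sum_add_distrib]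
  refine Finset.sum_congr rfl fun j _ => ?_
  have := smoothCutoff_add_smoothCutoff_one_sub (j / N : ℝ)
  have : (smoothCutoff (j / N) : ℂ) + (smoothCutoff (1 - j / N) : ℂ) = 1 := by exact_mod_cast this
  linear_combination (-(χ (j : ZMod q) * cotSummand s (j / N))) * this

theorem discreteOddL_eq {q : ℕ} (χ : DirichletCharacter ℂ q) (n : ℕ) (s : ℂ) :
    discreteOddL χ n s =
      ∑ j ∈ Finset.Ico 1 (q * n), χ (j : ZMod q) * cotSummand s (j / (q * n : ℕ)) := by
  refine Finset.sum_congr rfl fun j _ => ?_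
  simp only [cotSummand, Nat.cast_mul, mul_div_assoc]

/-! ### Error estimates and the asymptotic expansion -/

/-- The error of the smoothly truncated sum after `M` terms. -/
noncomputable def cotSumError {q : ℕ} [NeZero q] (χ : DirichletCharacter ℂ q) (s : ℂ) (M N : ℕ) :
    ℂ :=
  ∑ j ∈ Finset.Ico 1 N, χ (j : ZMod q) * ((smoothCutoff (j / N) : ℂ) * cotSummand s (j / N)) -
    ∑ k ∈ Finset.range M, (cotPoly k).eval s *
      DirichletCharacter.LFunction χ (1 + 2 * (s - (k : ℂ))) *
        ((N / (2 * Real.pi) : ℝ) : ℂ) ^ (1 + 2 * (s - (k : ℂ)))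

/-- The remainder after `M` terms is `x^β` times a smooth function, with `β = 2M - 1 - 2s`; the
hypothesis says `r < re β`, so it is of class `C^r`. -/
theorem cotSumError_isBigO_of_lt {q : ℕ} [NeZero q] {χ : DirichletCharacter ℂ q} (hχ : χ ≠ 1)
    (s : ℂ) {M r : ℕ} (hM : (r : ℝ) < 2 * M - 1 - 2 * s.re) :
    cotSumError χ s M =O[atTop] fun N : ℕ => (N : ℝ) ^ (1 - r : ℝ) := by
  obtain ⟨A, hA, hcot⟩ := exists_cotPow_remainder s M
  set β : ℂ := 2 * M - 1 - 2 * s with hβ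
  set α : ℕ → ℂ := fun k => 1 + 2 * (s - (k : ℂ)) with hα
  set W : ℝ → ℂ := fun x =>
    ((smoothCutoff x * smoothCutoff (-x) : ℝ) : ℂ) * A ((2 * Real.pi * x : ℝ) : ℂ) with hW
  have hβre : (r : ℝ) < β.re := by simpa [hβ] using hM
  have hF : ContDiff ℝ r fun x => posPow β x * W x :=
    (contDiff_posPow hβre).mul (contDiff_cutoff_mul_comp hA r)
  have hrem := sum_periodic_mul_isBigO χ (sum_apply_eq_zero_of_ne_one hχ) hF
    (fun x hx => by rw [posPow_of_nonpos β hx, zero_mul])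
    (fun x hx => by
      simp only [hW]
      rw [smoothCutoff_of_ge (by linarith)]; simp)
  have hmain : ∀ k, _ := fun k => sum_smoothCutoff_mul_cpow_isBigO hχ (α k) (1 - r : ℝ)
  have htot := (IsBigO.sum (s := Finset.range M) fun k _ =>
    (hmain k).const_mul_left ((cotPoly k).eval s * ((2 * Real.pi : ℝ) : ℂ) ^ (-α k))).add
      (hrem.const_mul_left (((2 * Real.pi : ℝ) : ℂ) ^ β))
  refine htot.congr' ?_ EventuallyEq.rfl
  filter_upwards [eventually_ge_atTop 1] with N hN
  have hN0 : (0 : ℝ) < N := by exact_mod_cast hN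
  have hpt : ∀ j ∈ Finset.Ico 1 N, (smoothCutoff (j / N) : ℂ) * cotSummand s (j / N) =
      ∑ k ∈ Finset.range M, (cotPoly k).eval s * ((2 * Real.pi : ℝ) : ℂ) ^ (-α k) *
        ((smoothCutoff (j / N) : ℂ) * (((j / N : ℝ) : ℂ)) ^ (-α k)) +
      ((2 * Real.pi : ℝ) : ℂ) ^ β * (posPow β (j / N) * W (j / N)) := by
    intro j hj
    rw [Finset.mem_Ico] at hj
    have hj0 : (0 : ℝ) < j := by exact_mod_cast hj.1
    have hjN : (j : ℝ) < N := by exact_mod_cast hj.2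
    set x : ℝ := j / N with hx
    have hx0 : 0 < x := div_pos hj0 hN0
    have hx1 : x < 1 := (div_lt_one hN0).mpr hjN
    have hz0 : (((2 * Real.pi * x : ℝ) : ℂ)) ≠ 0 := by
      exact_mod_cast (mul_pos Real.two_pi_pos hx0).ne'
    have hsplit : ∀ c : ℂ, (((2 * Real.pi * x : ℝ) : ℂ)) ^ c =
        ((2 * Real.pi : ℝ) : ℂ) ^ c * (x : ℂ) ^ c := fun c => by
      rw [Complex.ofReal_mul, Complex.mul_cpow_ofReal_nonneg Real.two_pi_pos.le hx0.le]
    have hWx : W x = (smoothCutoff x : ℂ) * A ((2 * Real.pi * x : ℝ) : ℂ) := by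
      simp only [hW]
      rw [smoothCutoff_of_le (by linarith : -x ≤ 1 / 3), mul_one]
    rw [cotSummand_eq_cotPow s hx0 hx1, hcot, mul_add, mul_add, Finset.mul_sum, Finset.mul_sum,
      posPow_of_pos β hx0, hWx]
    congr 1
    · refine Finset.sum_congr rfl fun k _ => ?_
      have : (((2 * Real.pi * x : ℝ) : ℂ)) ^ (-α k) = (((2 * Real.pi * x : ℝ) : ℂ)) ^ (-(1 + 2 * s)) *
          (((2 * Real.pi * x : ℝ) : ℂ)) ^ (2 * k) := by
        rw [← Complex.cpow_natCast, ← Complex.cpow_add _ _ hz0]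
        congr 1
        simp only [hα]; push_cast; ring
      rw [hsplit (-α k)] at this
      linear_combination (-(smoothCutoff x : ℂ) * (cotPoly k).eval s) * this
    · have : (((2 * Real.pi * x : ℝ) : ℂ)) ^ β = (((2 * Real.pi * x : ℝ) : ℂ)) ^ (-(1 + 2 * s)) *
          (((2 * Real.pi * x : ℝ) : ℂ)) ^ (2 * M) := by
        rw [← Complex.cpow_natCast, ← Complex.cpow_add _ _ hz0]
        congr 1
        rw [hβ]; push_cast; ring
      rw [hsplit β] at this
      linear_combination (-(smoothCutoff x : ℂ) * A ((2 * Real.pi * x : ℝ) : ℂ)) * this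
  have hNpow : ∀ c : ℂ, ((N / (2 * Real.pi) : ℝ) : ℂ) ^ c =
      ((2 * Real.pi : ℝ) : ℂ) ^ (-c) * (N : ℂ) ^ c := fun c => by
    rw [div_eq_inv_mul, Complex.ofReal_mul, Complex.mul_cpow_ofReal_nonneg
      (inv_nonneg.mpr Real.two_pi_pos.le) hN0.le, Complex.ofReal_inv, Complex.inv_cpow,
      Complex.cpow_neg, Complex.ofReal_natCast]
    rw [Complex.arg_ofReal_of_nonneg Real.two_pi_pos.le]
    exact Real.pi_pos.ne
  have hsum : ∑ j ∈ Finset.Ico 1 N,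
        χ (j : ZMod q) * ((smoothCutoff (j / N) : ℂ) * cotSummand s (j / N)) =
      ∑ k ∈ Finset.range M, (cotPoly k).eval s * ((2 * Real.pi : ℝ) : ℂ) ^ (-α k) *
        ∑ j ∈ Finset.Ico 1 N,
          χ (j : ZMod q) * ((smoothCutoff (j / N) : ℂ) * (((j / N : ℝ) : ℂ)) ^ (-α k)) +
      ((2 * Real.pi : ℝ) : ℂ) ^ β *
        ∑ j ∈ Finset.Ico 1 N, χ (j : ZMod q) * (posPow β (j / N) * W (j / N)) := by
    simp only [Finset.mul_sum]
    rw [Finset.sum_comm, ← Finset.sum_add_distrib]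
    refine Finset.sum_congr rfl fun j hj => ?_
    rw [hpt j hj, mul_add, Finset.mul_sum]
    congr 1
    · exact Finset.sum_congr rfl fun k _ => by ring
    · ring
  rw [cotSumError, hsum, Finset.sum_apply, add_sub_right_comm, ← Finset.sum_sub_distrib]
  congr 1
  refine Finset.sum_congr rfl fun k _ => ?_
  rw [hNpow]
  simp only [hα]
  ring

/-- Smoothness alone with `M = m + 1` would fall short of the claimed exponent. The expansion is
therefore carried to a larger `M`, and the surplus terms `m < k < M` are individually small enough
to discard. -/
theorem cotSumError_isBigO {q : ℕ} [NeZero q] {χ : DirichletCharacter ℂ q} (hχ : χ ≠ 1)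
    (s : ℂ) (m : ℕ) :
    cotSumError χ s (m + 1) =O[atTop] fun N : ℕ => (N : ℝ) ^ (1 + 2 * (s.re - (m + 1))) := by
  set K : ℝ := 1 + 2 * (s.re - (m + 1)) with hK
  obtain ⟨r, hr⟩ := exists_nat_ge (1 - K)
  obtain ⟨M', hM'⟩ := exists_nat_gt ((r + 1 + 2 * s.re) / 2)
  set M := max M' (m + 1) with hMdef
  have hM : (r : ℝ) < 2 * M - 1 - 2 * s.re := by
    have : (M' : ℝ) ≤ M := by exact_mod_cast le_max_left _ _
    linarith
  have hmM : m + 1 ≤ M := le_max_right _ _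
  have hpow : ∀ {c : ℝ}, c ≤ K → (fun N : ℕ => (N : ℝ) ^ c) =O[atTop] fun N : ℕ => (N : ℝ) ^ K := by
    intro c hc
    refine IsBigO.of_bound 1 ?_
    filter_upwards [eventually_ge_atTop 1] with N hN
    have hN' : (1 : ℝ) ≤ N := by exact_mod_cast hN
    rw [one_mul, Real.norm_of_nonneg (by positivity), Real.norm_of_nonneg (by positivity)]
    exact Real.rpow_le_rpow_of_exponent_le hN' hc
  have h1 := (cotSumError_isBigO_of_lt hχ s hM).trans (hpow (by linarith))
  have h2 : ∀ k ∈ Finset.Ico (m + 1) M, (fun N : ℕ => (cotPoly k).eval s *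
      DirichletCharacter.LFunction χ (1 + 2 * (s - (k : ℂ))) *
        ((N / (2 * Real.pi) : ℝ) : ℂ) ^ (1 + 2 * (s - (k : ℂ)))) =O[atTop]
      fun N : ℕ => (N : ℝ) ^ K := by
    intro k hk
    refine IsBigO.const_mul_left ?_ _
    have hk' : (m : ℝ) + 1 ≤ k := by exact_mod_cast (Finset.mem_Ico.mp hk).1
    refine IsBigO.trans (IsBigO.of_bound ((2 * Real.pi)⁻¹ ^ (1 + 2 * (s.re - k))) ?_)
      (hpow (c := 1 + 2 * (s.re - k)) (by rw [hK]; linarith))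
    filter_upwards [eventually_ge_atTop 1] with N hN
    have hN0 : (0 : ℝ) < N := by exact_mod_cast hN
    rw [Complex.norm_cpow_eq_rpow_re_of_pos (by positivity), Real.norm_of_nonneg (by positivity),
      div_eq_inv_mul, Real.mul_rpow (by positivity) hN0.le]
    simp
  refine (h1.add (IsBigO.sum h2)).congr_left fun N => ?_
  simp only [cotSumError, Finset.sum_apply]
  rw [← Finset.sum_range_add_sum_Ico _ hmM]
  ring

theorem theorem1p1 :
    ∃ b : ℕ → Polynomial ℂ,
      (∀ k : ℕ, (b k).degree = (k : WithBot ℕ)) ∧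
      (∀ s z : ℂ, 0 < ‖z‖ → ‖z‖ < 2 * Real.pi →
        HasSum (fun k : ℕ => (b k).eval s * z ^ (2 * (k : ℤ) - 1))
          (((z / 2) / Complex.sin (z / 2)) ^ (2 * s) * Complex.cot (z / 2))) ∧
      ∀ (q : ℕ) [NeZero q], 1 < q →
        ∀ χ : DirichletCharacter ℂ q, χ.Odd →
          ∀ (s : ℂ) (m : ℕ),
            (fun n : ℕ =>
              discreteOddL χ n s -
                2 * ∑ k ∈ Finset.range (m + 1),
                  (b k).eval s * DirichletCharacter.LFunction χ (1 + 2 * (s - (k : ℂ))) *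
                    (((q : ℝ) * (n : ℝ) / (2 * Real.pi) : ℝ) : ℂ) ^ (1 + 2 * (s - (k : ℂ))))
            =O[Filter.atTop]
              (fun n : ℕ => (n : ℂ) ^ (1 + 2 * (s - ((m : ℂ) + 1)))) := by
  refine ⟨cotPoly, degree_cotPoly, fun s z h0 h1 => hasSum_cotPoly s h0 h1,
    fun q _ hq χ hodd s m => ?_⟩
  have hχ : χ ≠ 1 := by
    rintro rfl
    have h : (1 : DirichletCharacter ℂ q) (-1) = -1 := hodd
    rw [MulChar.one_apply isUnit_one.neg] at h
    norm_num at h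
  have hq0 : 0 < q := by omega
  have htend : Tendsto (fun n : ℕ => q * n) atTop atTop := tendsto_id.const_mul_atTop' hq0
  have hmain := ((cotSumError_isBigO hχ s m).comp_tendsto htend).const_mul_left 2
  set K : ℝ := 1 + 2 * (s.re - (m + 1)) with hK
  have hscale : ((fun N : ℕ => (N : ℝ) ^ K) ∘ fun n : ℕ => q * n) =O[atTop]
      fun n : ℕ => (n : ℂ) ^ (1 + 2 * (s - ((m : ℂ) + 1))) := by
    -- The constant `q^K` comes from passing from `N = qn` to `n`.
    refine IsBigO.of_bound ((q : ℝ) ^ K) ?_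
    filter_upwards [eventually_ge_atTop 1] with n hn
    have hn0 : (0 : ℝ) < n := by exact_mod_cast hn
    rw [← Complex.ofReal_natCast, Complex.norm_cpow_eq_rpow_re_of_pos hn0]
    simp only [Function.comp_apply, Nat.cast_mul]
    rw [Real.norm_of_nonneg (by positivity), Real.mul_rpow (by positivity) hn0.le]
    simp [hK]
  refine (hmain.trans hscale).congr_left fun n => ?_
  simp only [Function.comp_apply]
  rw [discreteOddL_eq, sum_odd_mul_cotSummand hodd s (dvd_mul_right q n), cotSumError, mul_sub,
    Nat.cast_mul]
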